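/- Let $f,D,g:[0,1]\to\mathbb R$ satisfy: $f\in C^1[0,1]$ and $f(0)=0$; $D\in C^1[0,1]$, $D>0$ in $(0,1)$ and $D(1)=0$; $g\in C^0[0,1]$, $g>0$ in $(0,1]$ and $g(0)=0$; and $$\limsup_{\varphi\to0^+}\frac{D(\varphi)g(\varphi)}{\varphi}<+\infty .$$ Write $h=\dot f$ and consider the equation $$\rho_t+f(\rho)_x=\left(D(\rho)\rho_x\right)_x+g(\rho). \qquad (E)$$ Definitions. Let $I\subseteq\mathbb R$ be a nonempty open interval and $c\in\mathbb R$. A function $\varphi\in C(I)$ with values in $[0,1]$ is the profile of a traveling-wave solution $\rho(x,t)=\varphi(x-ct)$ of (E) with speed $c$ if $\varphi$ is differentiable a.e. in $I$, $D(\varphi)\varphi'\in L^1_{\rm loc}(I)$, the function $\xi\mapsto\int_0^{\varphi(\xi)}D(s)\,ds$ is locally absolutely continuous in $I$ (so that $D(\varphi)\varphi'$ is its weak derivative), and for every $\psi\in C_0^\infty(I)$ $$\int_I \left(D(\varphi)\varphi'-f(\varphi)+c\varphi\right)\psi'-g(\varphi)\psi\,d\xi=0 .$$ It is strict if $I\neq\mathbb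 R$ and $\varphi$ does not extend to a profile defined on $\mathbb R$ with the same speed $c$. It is a semi-wavefront to $0$ if $I=(a,\infty)$ for some $a\in\mathbb R$, $\varphi$ is monotone and non-constant, and $\varphi(\xi)\to0$ as $\xi\to\infty$; it connects $1$ to $0$ if moreover $\varphi(\xi)\to1$ as $\xi\to a^+$. Theorem. There exists $c^*\in\mathbb R$ satisfying $$\max\left\{\sup_{\varphi\in(0,1]}\frac{f(\varphi)}{\varphi},\ h(0)+2\sqrt{\liminf_{\varphi\to0^+}\frac{D(\varphi)g(\varphi)}{\varphi}}\right\}\le c^*\le 2\sqrt{\sup_{\varphi\in(0,1]}\frac{D(\varphi)g(\varphi)}{\varphi}}+\sup_{\varphi\in(0,1]}\frac{f(\varphi)}{\varphi}$$ such that, for every $c\in\mathbb R$, equation (E) has a strict semi-wavefront to $0$ with speed $c$ connecting $1$ to $0$ if and only if $c\ge c^*$. Moreover, if $\varphi$ is the profile of any such semi-wavefront, then $\varphi'(\xi)<0$ whenever $0<\varphi(\xi)<1$. -/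

import Mathlib

open Set Filter Topology MeasureTheory
open scoped ContDiff

/-- `F` is locally absolutely continuous in the interval `I`: it is absolutely continuous on every
compact interval contained in `I`. -/
def LocallyAbsolutelyContinuousOn (F : ℝ → ℝ) (I : Set ℝ) : Prop :=
  ∀ x y : ℝ, uIcc x y ⊆ I → AbsolutelyContinuousOnInterval F x y

/-- `φ`, defined on the open interval `I`, is the wave profile of a traveling-wave solution
`ρ(x,t) = φ(x - c t)` of `ρ_t + f(ρ)_x = (D(ρ) ρ_x)_x + g(ρ)` with wave speed `c`.
The functions `f`, `D`, `g` are only evaluated on `[0,1]` and `φ` only on `I`. -/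
structure IsTravelingWaveProfile (f D g : ℝ → ℝ) (I : Set ℝ) (c : ℝ) (φ : ℝ → ℝ) : Prop where
  isOpen : IsOpen I
  ordConnected : I.OrdConnected
  nonempty : I.Nonempty
  continuousOn : ContinuousOn φ I
  mapsTo : MapsTo φ I (Icc 0 1)
  ae_differentiableAt : ∀ᵐ ξ ∂(volume.restrict I), DifferentiableAt ℝ φ ξ
  locallyIntegrableOn : LocallyIntegrableOn (fun ξ => D (φ ξ) * deriv φ ξ) I
  /-- The flux `D(φ) φ'` is the derivative of `∫₀^φ D` in the weak sense, and not only almost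
  everywhere (so Cantor-like singular parts of `φ` are excluded). -/
  locallyAbsolutelyContinuousOn :
    LocallyAbsolutelyContinuousOn (fun ξ => ∫ s in (0 : ℝ)..(φ ξ), D s) I
  weak_equation : ∀ ψ : ℝ → ℝ, ContDiff ℝ ∞ ψ → HasCompactSupport ψ → tsupport ψ ⊆ I →
    ∫ ξ in I, ((D (φ ξ) * deriv φ ξ - f (φ ξ) + c * φ ξ) * deriv ψ ξ - g (φ ξ) * ψ ξ) = 0

/-- A traveling wave with profile `φ` on `I` is strict if `I ≠ ℝ` and `φ` does not extend to
the profile of a traveling wave on `ℝ` with the same speed. -/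
def IsStrictProfile (f D g : ℝ → ℝ) (I : Set ℝ) (c : ℝ) (φ : ℝ → ℝ) : Prop :=
  I ≠ univ ∧ ¬ ∃ φ₁ : ℝ → ℝ, IsTravelingWaveProfile f D g univ c φ₁ ∧ EqOn φ₁ φ I

/-- `φ` is the profile, on `(a,∞)`, of a semi-wavefront to `0` with speed `c`. -/
structure IsSemiWavefrontToZero (f D g : ℝ → ℝ) (a c : ℝ) (φ : ℝ → ℝ) : Prop where
  isTravelingWaveProfile : IsTravelingWaveProfile f D g (Ioi a) c φ
  monotonic : MonotoneOn φ (Ioi a) ∨ AntitoneOn φ (Ioi a)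
  nonconstant : ∃ ξ₁ ∈ Ioi a, ∃ ξ₂ ∈ Ioi a, φ ξ₁ ≠ φ ξ₂
  tendsto_atTop : Tendsto φ atTop (𝓝 0)

/-- `φ` is the profile, on `(a,∞)`, of a strict semi-wavefront to `0` with speed `c` which
connects `1` to `0`. -/
def IsStrictSemiWavefrontOneZero (f D g : ℝ → ℝ) (a c : ℝ) (φ : ℝ → ℝ) : Prop :=
  IsSemiWavefrontToZero f D g a c φ ∧ IsStrictProfile f D g (Ioi a) c φ ∧
    Tendsto φ (𝓝[>] a) (𝓝 1)

/-!
In a nonincreasing profile `φ` of speed `c`, the flux `D(φ) φ'` is a function of the value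
`u = φ`; write it as `- w u`. The travelling-wave equation then becomes the singular first-order
problem `w' = c - h - q / w`, `w > 0` on `(0,1)`, `w 0 = 0`, with `h = f'` and `q = D g`
(`IsSingularSolution`). The theorem is the study of this problem together with the passage between
`φ` and `w`.

*The singular problem.* In integral form it reads `w u = c u - f u - ∫₀ᵘ q / w`, whose right-hand
side is monotone in `w`. Iterating from `c u - f u`, a positive subsolution gives a solution that
is moreover maximal (`IsSingularSubsolution.exists_maximal_solution`). Hence the admissible speeds
are closed upwards, and `√M u` with `M = sup q / u` is a subsolution for the speed
`2 √M + sup f / u`. The set of admissible speeds is closed: the maximal solutions decrease with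
`c`, and the limit solves `(w²)' = 2 (c - h) w - 2 q`, an equation without singularity which
forces `w > 0` (`IsSingularSolution.exists_of_forall_gt`). The lower bounds come from
`w u ≤ c u - f u` and from a logarithmic growth estimate for `w / u`
(`IsSingularSolution.add_two_mul_sqrt_le_speed`).

*From `φ` to `w`.* By the du Bois-Reymond lemma and the absolute continuity of `∫₀^φ D`, the flux
has a continuous representative `z`, and `(z - f(φ) + c φ)' = - g(φ)` holds classically
(`IsTravelingWaveProfile.exists_flux`). At a zero of `z` with `0 < φ < 1` the nonpositive function
`z` would have derivative `- g(φ) < 0` at an interior maximum, so `z < 0`, that is `φ' < 0`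
(`IsFlux.flux_neg`); then `φ` can be inverted. The condition `w 0 = 0` follows from
`z - f(φ) + c φ ≥ 0` (`IsFlux.balance_nonneg`).

*From `w` to `φ`.* The profile is the inverse of `u ↦ ∫_u^{1/2} D / w`, extended by zero. It
reaches `1` at a finite point because `D / w ≤ (q / w) / min g` near `u = 1` and `q / w` is the
derivative of the bounded function `c u - f u - w`. Strictness is automatic: a nonzero profile on
the whole line tending to `0` at `+∞` does not exist (`IsFlux.not_univ`), since `g > 0` away
from `0`.
-/

/-! ### The singular first-order problem -/

/-- Standing assumptions on the coefficients of the singular equation `w' = c - h - q / w` on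
`(0,1)`: `h` is the derivative of the convective flux `f`, and `q` is the product `D g`. -/
structure IsSingularData (f h q : ℝ → ℝ) : Prop where
  continuousOn_f : ContinuousOn f (Icc 0 1)
  f_zero : f 0 = 0
  continuousOn_h : ContinuousOn h (Icc 0 1)
  hasDerivAt_f : ∀ u ∈ Ioo (0 : ℝ) 1, HasDerivAt f (h u) u
  continuousOn_q : ContinuousOn q (Icc 0 1)
  q_pos : ∀ u ∈ Ioo (0 : ℝ) 1, 0 < q u

/-- `w` is a positive solution on `(0,1)` of the singular equation `w' = c - h - q / w` with
`w 0 = 0`. For a wave profile `φ` one has `w (φ ξ) = - D (φ ξ) φ' ξ`. -/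
structure IsSingularSolution (h q : ℝ → ℝ) (c : ℝ) (w : ℝ → ℝ) : Prop where
  continuousOn : ContinuousOn w (Ico 0 1)
  zero : w 0 = 0
  pos : ∀ u ∈ Ioo (0 : ℝ) 1, 0 < w u
  hasDerivAt : ∀ u ∈ Ioo (0 : ℝ) 1, HasDerivAt w (c - h u - q u / w u) u

/-- `v` is a positive subsolution of the integral form `w u = c u - f u - ∫₀ᵘ q / w` of the
singular equation. -/
structure IsSingularSubsolution (f q : ℝ → ℝ) (c : ℝ) (v : ℝ → ℝ) : Prop where
  pos : ∀ u ∈ Ioo (0 : ℝ) 1, 0 < v u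
  intervalIntegrable : ∀ u ∈ Ioo (0 : ℝ) 1, IntervalIntegrable (fun s => q s / v s) volume 0 u
  le : ∀ u ∈ Ioo (0 : ℝ) 1, v u ≤ c * u - f u - ∫ s in (0 : ℝ)..u, q s / v s

lemma continuousOn_primitive_Ico {k : ℝ → ℝ}
    (hk : ∀ u ∈ Ioo (0 : ℝ) 1, IntervalIntegrable k volume 0 u) :
    ContinuousOn (fun u => ∫ s in (0 : ℝ)..u, k s) (Ico 0 1) := by
  intro t ht
  have hb : (t + 1) / 2 ∈ Ioo (0 : ℝ) 1 := ⟨by linarith [ht.1], by linarith [ht.2]⟩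
  have h1 : ContinuousOn (fun u => ∫ s in (0 : ℝ)..u, k s) (Icc 0 ((t + 1) / 2)) := by
    have := intervalIntegral.continuousOn_primitive_interval' (hk _ hb)
      (left_mem_uIcc)
    rwa [uIcc_of_le hb.1.le] at this
  refine (h1 t ⟨ht.1, by linarith [ht.2]⟩).mono_of_mem_nhdsWithin ?_
  have : Ico (0 : ℝ) 1 ∩ Iio ((t + 1) / 2) ∈ 𝓝[Ico 0 1] t :=
    inter_mem self_mem_nhdsWithin
      (mem_nhdsWithin_of_mem_nhds (Iio_mem_nhds (by linarith [ht.2])))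
  exact mem_of_superset this fun x hx => ⟨hx.1.1, hx.2.le⟩

namespace IsSingularSolution

variable {f h q w : ℝ → ℝ} {c : ℝ}

lemma hasDerivAt_gap (hw : IsSingularSolution h q c w) (hd : IsSingularData f h q) {u : ℝ}
    (hu : u ∈ Ioo (0 : ℝ) 1) : HasDerivAt (fun s => c * s - f s - w s) (q u / w u) u := by
  have := (((hasDerivAt_id u).const_mul c).sub (hd.hasDerivAt_f u hu)).sub (hw.hasDerivAt u hu)
  exact this.congr_deriv (by ring)

lemma continuousOn_gap (hw : IsSingularSolution h q c w) (hd : IsSingularData f h q) :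
    ContinuousOn (fun s => c * s - f s - w s) (Ico 0 1) :=
  ((continuousOn_const.mul continuousOn_id).sub
    (hd.continuousOn_f.mono Ico_subset_Icc_self)).sub hw.continuousOn

lemma monotoneOn_gap (hw : IsSingularSolution h q c w) (hd : IsSingularData f h q) :
    MonotoneOn (fun s => c * s - f s - w s) (Ico 0 1) := by
  refine monotoneOn_of_deriv_nonneg (convex_Ico 0 1) (hw.continuousOn_gap hd) ?_ ?_
  · rw [interior_Ico]
    exact fun u hu => (hw.hasDerivAt_gap hd hu).differentiableAt.differentiableWithinAt
  · rw [interior_Ico]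
    intro u hu
    rw [(hw.hasDerivAt_gap hd hu).deriv]
    exact (div_pos (hd.q_pos u hu) (hw.pos u hu)).le

lemma le_linear (hw : IsSingularSolution h q c w) (hd : IsSingularData f h q) {u : ℝ}
    (hu : u ∈ Ico (0 : ℝ) 1) : w u ≤ c * u - f u := by
  have := hw.monotoneOn_gap hd ⟨le_rfl, zero_lt_one⟩ hu hu.1
  simp only [mul_zero, hd.f_zero, hw.zero, sub_zero] at this
  linarith

lemma intervalIntegrable (hw : IsSingularSolution h q c w) (hd : IsSingularData f h q) {u : ℝ}
    (hu : u ∈ Ioo (0 : ℝ) 1) : IntervalIntegrable (fun s => q s / w s) volume 0 u := by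
  rw [intervalIntegrable_iff_integrableOn_Ioc_of_le hu.1.le]
  have hsub : ∀ s ∈ Ioo 0 u, s ∈ Ioo (0 : ℝ) 1 := fun s hs => ⟨hs.1, hs.2.trans hu.2⟩
  refine intervalIntegral.integrableOn_deriv_of_nonneg
    ((hw.continuousOn_gap hd).mono (Icc_subset_Ico_right hu.2))
    (fun s hs => hw.hasDerivAt_gap hd (hsub s hs))
    (fun s hs => (div_pos (hd.q_pos s (hsub s hs)) (hw.pos s (hsub s hs))).le)

lemma integral_eq (hw : IsSingularSolution h q c w) (hd : IsSingularData f h q) {u : ℝ}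
    (hu : u ∈ Ioo (0 : ℝ) 1) : ∫ s in (0 : ℝ)..u, q s / w s = c * u - f u - w u := by
  rw [intervalIntegral.integral_eq_sub_of_hasDerivAt_of_le hu.1.le
    ((hw.continuousOn_gap hd).mono (Icc_subset_Ico_right hu.2))
    (fun s hs => hw.hasDerivAt_gap hd ⟨hs.1, hs.2.trans hu.2⟩) (hw.intervalIntegrable hd hu)]
  simp [hd.f_zero, hw.zero]

lemma isSingularSubsolution (hw : IsSingularSolution h q c w) (hd : IsSingularData f h q)
    {c' : ℝ} (hc : c ≤ c') : IsSingularSubsolution f q c' w where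
  pos := hw.pos
  intervalIntegrable _ hu := hw.intervalIntegrable hd hu
  le u hu := by
    rw [hw.integral_eq hd hu]
    nlinarith [hu.1]

end IsSingularSolution

/-- The monotone iteration `w ↦ c u - f u - ∫₀ᵘ q / w` for the singular problem, started at the
upper bound `c u - f u` of all solutions. -/
noncomputable def singularIter (f q : ℝ → ℝ) (c : ℝ) : ℕ → ℝ → ℝ
  | 0 => fun u => c * u - f u
  | n + 1 => fun u => c * u - f u - ∫ s in (0 : ℝ)..u, q s / singularIter f q c n s

namespace IsSingularSubsolution

variable {f h q v : ℝ → ℝ} {c : ℝ}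

lemma intervalIntegrable_of_le (hv : IsSingularSubsolution f q c v) (hd : IsSingularData f h q)
    {w : ℝ → ℝ} {u : ℝ} (hu : u ∈ Ioo (0 : ℝ) 1)
    (hm : AEStronglyMeasurable (fun s => q s / w s) (volume.restrict (Ioc 0 u)))
    (hle : ∀ s ∈ Ioo (0 : ℝ) 1, v s ≤ w s) :
    IntervalIntegrable (fun s => q s / w s) volume 0 u := by
  refine (hv.intervalIntegrable u hu).mono_fun (by rwa [uIoc_of_le hu.1.le]) ?_
  rw [uIoc_of_le hu.1.le, EventuallyLE, ae_restrict_iff' measurableSet_Ioc]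
  refine ae_of_all _ fun s hs => ?_
  have hs' : s ∈ Ioo (0 : ℝ) 1 := ⟨hs.1, hs.2.trans_lt hu.2⟩
  have h1 := hv.pos s hs'
  have h2 := hle s hs'
  have h3 := hd.q_pos s hs'
  rw [Real.norm_of_nonneg (div_pos h3 (h1.trans_le h2)).le, Real.norm_of_nonneg (div_pos h3 h1).le]
  gcongr

lemma aestronglyMeasurable_of_continuousOn (hv : IsSingularSubsolution f q c v)
    (hd : IsSingularData f h q) {w : ℝ → ℝ} {u : ℝ} (hu : u ∈ Ioo (0 : ℝ) 1)
    (hw : ContinuousOn w (Ico 0 1)) (hle : ∀ s ∈ Ioo (0 : ℝ) 1, v s ≤ w s) :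
    AEStronglyMeasurable (fun s => q s / w s) (volume.restrict (Ioc 0 u)) := by
  have hsub : Ioc 0 u ⊆ Ioo (0 : ℝ) 1 := fun s hs => ⟨hs.1, hs.2.trans_lt hu.2⟩
  refine ContinuousOn.aestronglyMeasurable ?_ measurableSet_Ioc
  exact (hd.continuousOn_q.mono (hsub.trans Ioo_subset_Icc_self)).div
    (hw.mono (hsub.trans Ioo_subset_Ico_self))
    fun s hs => ((hv.pos s (hsub hs)).trans_le (hle s (hsub hs))).ne'

lemma singularIter_aux (hv : IsSingularSubsolution f q c v) (hd : IsSingularData f h q) (n : ℕ) :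
    ContinuousOn (singularIter f q c n) (Ico 0 1) ∧
      ∀ u ∈ Ioo (0 : ℝ) 1, v u ≤ singularIter f q c n u := by
  induction n with
  | zero =>
    refine ⟨(continuousOn_const.mul continuousOn_id).sub
      (hd.continuousOn_f.mono Ico_subset_Icc_self), fun u hu => (hv.le u hu).trans ?_⟩
    have : 0 ≤ ∫ s in (0 : ℝ)..u, q s / v s := by
      refine intervalIntegral.integral_nonneg_of_ae_restrict hu.1.le ?_
      rw [← Measure.restrict_congr_set Ioo_ae_eq_Icc, EventuallyLE,
        ae_restrict_iff' measurableSet_Ioo]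
      refine ae_of_all _ fun s hs => ?_
      have hs' : s ∈ Ioo (0 : ℝ) 1 := ⟨hs.1, hs.2.trans hu.2⟩
      exact (div_pos (hd.q_pos s hs') (hv.pos s hs')).le
    simp only [singularIter]
    linarith
  | succ n ih =>
    have hint : ∀ u ∈ Ioo (0 : ℝ) 1,
        IntervalIntegrable (fun s => q s / singularIter f q c n s) volume 0 u := fun u hu =>
      hv.intervalIntegrable_of_le hd hu
        (hv.aestronglyMeasurable_of_continuousOn hd hu ih.1 ih.2) ih.2
    refine ⟨((continuousOn_const.mul continuousOn_id).sub
      (hd.continuousOn_f.mono Ico_subset_Icc_self)).sub (continuousOn_primitive_Ico hint),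
      fun u hu => (hv.le u hu).trans ?_⟩
    simp only [singularIter]
    refine sub_le_sub_left ?_ _
    refine intervalIntegral.integral_mono_on_of_le_Ioo hu.1.le (hint u hu)
      (hv.intervalIntegrable u hu) fun s hs => ?_
    have hs' : s ∈ Ioo (0 : ℝ) 1 := ⟨hs.1, hs.2.trans hu.2⟩
    have := hd.q_pos s hs'
    have := hv.pos s hs'
    have := ih.2 s hs'
    gcongr

lemma intervalIntegrable_singularIter (hv : IsSingularSubsolution f q c v)
    (hd : IsSingularData f h q) (n : ℕ) {u : ℝ} (hu : u ∈ Ioo (0 : ℝ) 1) :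
    IntervalIntegrable (fun s => q s / singularIter f q c n s) volume 0 u :=
  hv.intervalIntegrable_of_le hd hu
    (hv.aestronglyMeasurable_of_continuousOn hd hu (hv.singularIter_aux hd n).1
      (hv.singularIter_aux hd n).2) (hv.singularIter_aux hd n).2

lemma singularIter_zero (hd : IsSingularData f h q) (n : ℕ) : singularIter f q c n 0 = 0 := by
  cases n <;> simp [singularIter, hd.f_zero]

lemma singularIter_succ_le (hv : IsSingularSubsolution f q c v) (hd : IsSingularData f h q)
    (n : ℕ) : ∀ u ∈ Ioo (0 : ℝ) 1, singularIter f q c (n + 1) u ≤ singularIter f q c n u := by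
  have hpos : ∀ n, ∀ s ∈ Ioo (0 : ℝ) 1, 0 < singularIter f q c n s := fun n s hs =>
    (hv.pos s hs).trans_le ((hv.singularIter_aux hd n).2 s hs)
  induction n with
  | zero =>
    intro u hu
    have : 0 ≤ ∫ s in (0 : ℝ)..u, q s / singularIter f q c 0 s := by
      refine intervalIntegral.integral_nonneg_of_ae_restrict hu.1.le ?_
      rw [← Measure.restrict_congr_set Ioo_ae_eq_Icc, EventuallyLE,
        ae_restrict_iff' measurableSet_Ioo]
      refine ae_of_all _ fun s hs => ?_
      have hs' : s ∈ Ioo (0 : ℝ) 1 := ⟨hs.1, hs.2.trans hu.2⟩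
      exact (div_pos (hd.q_pos s hs') (hpos 0 s hs')).le
    rw [singularIter]
    simp only [singularIter] at this ⊢
    linarith
  | succ n ih =>
    intro u hu
    rw [singularIter, singularIter]
    refine sub_le_sub_left ?_ _
    refine intervalIntegral.integral_mono_on_of_le_Ioo hu.1.le
      (hv.intervalIntegrable_singularIter hd n hu)
      (hv.intervalIntegrable_singularIter hd (n + 1) hu) fun s hs => ?_
    have hs' : s ∈ Ioo (0 : ℝ) 1 := ⟨hs.1, hs.2.trans hu.2⟩
    exact div_le_div_of_nonneg_left (hd.q_pos s hs').le (hpos (n + 1) s hs') (ih s hs')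

end IsSingularSubsolution

lemma IsSingularSolution.of_integral_eq {f h q w : ℝ → ℝ} {c : ℝ} (hd : IsSingularData f h q)
    (hpos : ∀ u ∈ Ioo (0 : ℝ) 1, 0 < w u)
    (hint : ∀ u ∈ Ioo (0 : ℝ) 1, IntervalIntegrable (fun s => q s / w s) volume 0 u)
    (heq : ∀ u ∈ Ico (0 : ℝ) 1, w u = c * u - f u - ∫ s in (0 : ℝ)..u, q s / w s) :
    IsSingularSolution h q c w := by
  have hcont : ContinuousOn w (Ico 0 1) :=
    (((continuousOn_const.mul continuousOn_id).sub
      (hd.continuousOn_f.mono Ico_subset_Icc_self)).sub (continuousOn_primitive_Ico hint)).congr heq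
  refine ⟨hcont, by simpa [hd.f_zero] using heq 0 ⟨le_rfl, one_pos⟩, hpos, fun u hu => ?_⟩
  have hc' : ContinuousOn (fun s => q s / w s) (Ioo 0 1) :=
    (hd.continuousOn_q.mono Ioo_subset_Icc_self).div (hcont.mono Ioo_subset_Ico_self)
      fun s hs => (hpos s hs).ne'
  have hI : HasDerivAt (fun u => ∫ s in (0 : ℝ)..u, q s / w s) (q u / w u) u :=
    intervalIntegral.integral_hasDerivAt_right (hint u hu)
      (hc'.stronglyMeasurableAtFilter isOpen_Ioo u hu)
      (hc'.continuousAt (isOpen_Ioo.mem_nhds hu))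
  have := (((hasDerivAt_id u).const_mul c).sub (hd.hasDerivAt_f u hu)).sub hI
  simp only [id, mul_one] at this
  refine this.congr_of_eventuallyEq ?_
  filter_upwards [isOpen_Ioo.mem_nhds hu] with s hs
  exact heq s ⟨hs.1.le, hs.2⟩

/-- A positive subsolution yields a positive solution lying above every subsolution: the monotone
iteration started at `c u - f u` decreases and stays above all subsolutions. -/
lemma IsSingularSubsolution.exists_maximal_solution {f h q v : ℝ → ℝ} {c : ℝ}
    (hv : IsSingularSubsolution f q c v) (hd : IsSingularData f h q) :
    ∃ w, IsSingularSolution h q c w ∧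
      ∀ v', IsSingularSubsolution f q c v' → ∀ u ∈ Ioo (0 : ℝ) 1, v' u ≤ w u := by
  set W := singularIter f q c with hW
  set w : ℝ → ℝ := fun u => ⨅ n, W n u with hw
  have hanti : ∀ u ∈ Ioo (0 : ℝ) 1, Antitone fun n => W n u := fun u hu =>
    antitone_nat_of_succ_le fun n => hv.singularIter_succ_le hd n u hu
  have hlim : ∀ u ∈ Ico (0 : ℝ) 1, Tendsto (fun n => W n u) atTop (𝓝 (w u)) := by
    intro u hu
    rcases hu.1.eq_or_lt with rfl | h0
    · have : ∀ n, W n 0 = 0 := IsSingularSubsolution.singularIter_zero hd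
      simp [hw, this]
    · refine tendsto_atTop_ciInf (hanti u ⟨h0, hu.2⟩) ⟨v u, ?_⟩
      rintro _ ⟨n, rfl⟩
      exact (hv.singularIter_aux hd n).2 u ⟨h0, hu.2⟩
  have hmax : ∀ v', IsSingularSubsolution f q c v' → ∀ u ∈ Ioo (0 : ℝ) 1, v' u ≤ w u :=
    fun v' hv' u hu => le_ciInf fun n => (hv'.singularIter_aux hd n).2 u hu
  have hpos : ∀ u ∈ Ioo (0 : ℝ) 1, 0 < w u := fun u hu => (hv.pos u hu).trans_le (hmax v hv u hu)
  have hqlim : ∀ s ∈ Ioo (0 : ℝ) 1,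
      Tendsto (fun n => q s / W n s) atTop (𝓝 (q s / w s)) := fun s hs =>
    tendsto_const_nhds.div (hlim s ⟨hs.1.le, hs.2⟩) (hpos s hs).ne'
  have hsub : ∀ u ∈ Ioo (0 : ℝ) 1, ∀ s ∈ Ioc 0 u, s ∈ Ioo (0 : ℝ) 1 :=
    fun u hu s hs => ⟨hs.1, hs.2.trans_lt hu.2⟩
  have hmeasn : ∀ u ∈ Ioo (0 : ℝ) 1, ∀ n,
      AEStronglyMeasurable (fun s => q s / W n s) (volume.restrict (Ioc 0 u)) := fun u hu n =>
    hv.aestronglyMeasurable_of_continuousOn hd hu (hv.singularIter_aux hd n).1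
      (hv.singularIter_aux hd n).2
  have hint : ∀ u ∈ Ioo (0 : ℝ) 1, IntervalIntegrable (fun s => q s / w s) volume 0 u := by
    intro u hu
    refine hv.intervalIntegrable_of_le hd hu ?_ (hmax v hv)
    refine aestronglyMeasurable_of_tendsto_ae atTop (hmeasn u hu) ?_
    rw [ae_restrict_iff' measurableSet_Ioc]
    exact ae_of_all _ fun s hs => hqlim s (hsub u hu s hs)
  refine ⟨w, IsSingularSolution.of_integral_eq hd hpos hint fun u hu => ?_, hmax⟩
  rcases hu.1.eq_or_lt with rfl | h0
  · have : ∀ n, W n 0 = 0 := IsSingularSubsolution.singularIter_zero hd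
    simp [hw, this, hd.f_zero]
  have hu' : u ∈ Ioo (0 : ℝ) 1 := ⟨h0, hu.2⟩
  have hI : Tendsto (fun n => ∫ s in (0 : ℝ)..u, q s / W n s) atTop
      (𝓝 (∫ s in (0 : ℝ)..u, q s / w s)) := by
    refine intervalIntegral.tendsto_integral_filter_of_dominated_convergence
      (fun s => q s / v s) (Eventually.of_forall fun n => ?_) (Eventually.of_forall fun n => ?_)
      (hv.intervalIntegrable u hu') ?_
    · rw [uIoc_of_le h0.le]
      exact hmeasn u hu' n
    · refine ae_of_all _ fun s hs => ?_
      rw [uIoc_of_le h0.le] at hs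
      have hs' := hsub u hu' s hs
      have h1 := hv.pos s hs'
      have h2 := (hv.singularIter_aux hd n).2 s hs'
      have h3 := hd.q_pos s hs'
      rw [Real.norm_of_nonneg (div_pos h3 (h1.trans_le h2)).le]
      gcongr
    · refine ae_of_all _ fun s hs => ?_
      rw [uIoc_of_le h0.le] at hs
      exact hqlim s (hsub u hu' s hs)
  exact tendsto_nhds_unique ((tendsto_add_atTop_iff_nat 1).2 (hlim u hu))
    (tendsto_const_nhds.sub hI)

namespace IsSingularSolution

variable {f h q w : ℝ → ℝ} {c : ℝ}

lemma hasDerivAt_sq (hw : IsSingularSolution h q c w) {u : ℝ} (hu : u ∈ Ioo (0 : ℝ) 1) :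
    HasDerivAt (fun s => w s ^ 2) (2 * ((c - h u) * w u - q u)) u := by
  refine ((hw.hasDerivAt u hu).pow 2).congr_deriv ?_
  have := (hw.pos u hu).ne'
  field_simp
  norm_num
  ring

lemma integral_sq (hw : IsSingularSolution h q c w) (hd : IsSingularData f h q) {u : ℝ}
    (hu : u ∈ Ioo (0 : ℝ) 1) :
    ∫ s in (0 : ℝ)..u, 2 * ((c - h s) * w s - q s) = w u ^ 2 := by
  have hc : ContinuousOn w (Icc 0 u) := hw.continuousOn.mono (Icc_subset_Ico_right hu.2)
  have hs : Icc 0 u ⊆ Icc (0 : ℝ) 1 := Icc_subset_Icc_right hu.2.le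
  rw [intervalIntegral.integral_eq_sub_of_hasDerivAt_of_le hu.1.le (hc.pow 2)
    (fun s hs => hw.hasDerivAt_sq ⟨hs.1, hs.2.trans hu.2⟩)]
  · simp [hw.zero]
  · refine ContinuousOn.intervalIntegrable_of_Icc hu.1.le ?_
    exact continuousOn_const.mul (((continuousOn_const.sub (hd.continuousOn_h.mono hs)).mul hc).sub
      (hd.continuousOn_q.mono hs))

/-- A bounded nonnegative `w` with `w² = ∫ 2 ((c - h) w - q)` solves the singular problem: the
equation for `w²` has no singularity, and at an interior zero of `w` the derivative of `w²` would
be `-2 q < 0`, although `w²` is minimal there. -/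
lemma of_integral_sq (hd : IsSingularData f h q)
    (hnonneg : ∀ u ∈ Ico (0 : ℝ) 1, 0 ≤ w u)
    (hint : ∀ u ∈ Ioo (0 : ℝ) 1,
      IntervalIntegrable (fun s => 2 * ((c - h s) * w s - q s)) volume 0 u)
    (heq : ∀ u ∈ Ico (0 : ℝ) 1, w u ^ 2 = ∫ s in (0 : ℝ)..u, 2 * ((c - h s) * w s - q s)) :
    IsSingularSolution h q c w := by
  have hsq : ContinuousOn (fun u => w u ^ 2) (Ico 0 1) :=
    (continuousOn_primitive_Ico hint).congr heq
  have hcont : ContinuousOn w (Ico 0 1) :=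
    hsq.sqrt.congr fun u hu => (Real.sqrt_sq (hnonneg u hu)).symm
  have hk : ContinuousOn (fun s => 2 * ((c - h s) * w s - q s)) (Ioo 0 1) :=
    continuousOn_const.mul (((continuousOn_const.sub
      (hd.continuousOn_h.mono Ioo_subset_Icc_self)).mul (hcont.mono Ioo_subset_Ico_self)).sub
      (hd.continuousOn_q.mono Ioo_subset_Icc_self))
  have hder : ∀ u ∈ Ioo (0 : ℝ) 1,
      HasDerivAt (fun s => w s ^ 2) (2 * ((c - h u) * w u - q u)) u := by
    intro u hu
    have : HasDerivAt (fun u => ∫ s in (0 : ℝ)..u, 2 * ((c - h s) * w s - q s))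
        (2 * ((c - h u) * w u - q u)) u :=
      intervalIntegral.integral_hasDerivAt_right (hint u hu)
        (hk.stronglyMeasurableAtFilter isOpen_Ioo u hu) (hk.continuousAt (isOpen_Ioo.mem_nhds hu))
    refine this.congr_of_eventuallyEq ?_
    filter_upwards [isOpen_Ioo.mem_nhds hu] with s hs
    exact heq s ⟨hs.1.le, hs.2⟩
  have hpos : ∀ u ∈ Ioo (0 : ℝ) 1, 0 < w u := by
    intro u hu
    refine (hnonneg u ⟨hu.1.le, hu.2⟩).lt_of_ne fun h0 => ?_
    have hmin : IsLocalMin (fun s => w s ^ 2) u := by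
      refine Eventually.of_forall fun s => ?_
      simp only [← h0]
      nlinarith [sq_nonneg (w s)]
    have := hmin.hasDerivAt_eq_zero (hder u hu)
    rw [← h0] at this
    linarith [hd.q_pos u hu]
  refine ⟨hcont, ?_, hpos, fun u hu => ?_⟩
  · simpa using heq 0 ⟨le_rfl, one_pos⟩
  · have hw0 := hpos u hu
    have := (hder u hu).sqrt (by positivity)
    rw [Real.sqrt_sq hw0.le] at this
    refine (this.congr_of_eventuallyEq ?_).congr_deriv ?_
    · filter_upwards [isOpen_Ioo.mem_nhds hu] with s hs
      exact (Real.sqrt_sq (hpos s hs).le).symm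
    · field_simp

/-- A decreasing limit of admissible speeds is admissible: the maximal solutions decrease with the
speed, and one passes to the limit in the equation for the squares. -/
lemma exists_of_forall_gt (hd : IsSingularData f h q)
    (H : ∀ c' > c, ∃ w, IsSingularSolution h q c' w) : ∃ w, IsSingularSolution h q c w := by
  have H' : ∀ c' > c, ∃ w, IsSingularSolution h q c' w ∧
      ∀ v', IsSingularSubsolution f q c' v' → ∀ u ∈ Ioo (0 : ℝ) 1, v' u ≤ w u := fun c' hc' => by
    obtain ⟨w, hw⟩ := H c' hc'
    exact (hw.isSingularSubsolution hd le_rfl).exists_maximal_solution hd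
  choose! V hV hVmax using H'
  set C : ℕ → ℝ := fun n => c + 1 / ((n : ℝ) + 1) with hC
  have hCgt : ∀ n, c < C n := fun n => by
    simp only [hC]
    linarith [Nat.one_div_pos_of_nat (n := n) (α := ℝ)]
  have hCle : ∀ n, C n ≤ c + 1 := fun n => by
    have : 1 / ((n : ℝ) + 1) ≤ 1 := by
      rw [div_le_one (by positivity)]
      linarith [(Nat.cast_nonneg n : (0 : ℝ) ≤ n)]
    simp only [hC]; linarith
  have hCanti : ∀ n, C (n + 1) ≤ C n := fun n => by
    simp only [hC]
    push_cast
    gcongr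
    linarith
  have hClim : Tendsto C atTop (𝓝 c) := by
    have := (tendsto_const_nhds (x := c)).add (tendsto_one_div_add_atTop_nhds_zero_nat (𝕜 := ℝ))
    rwa [add_zero] at this
  set W : ℕ → ℝ → ℝ := fun n => V (C n) with hWdef
  have hW : ∀ n, IsSingularSolution h q (C n) (W n) := fun n => hV _ (hCgt n)
  have hW0 : ∀ n, ∀ u ∈ Ico (0 : ℝ) 1, 0 ≤ W n u := by
    intro n u hu
    rcases hu.1.eq_or_lt with rfl | h0
    · exact (hW n).zero.ge
    · exact ((hW n).pos u ⟨h0, hu.2⟩).le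
  have hanti : ∀ u ∈ Ico (0 : ℝ) 1, Antitone fun n => W n u := by
    intro u hu
    refine antitone_nat_of_succ_le fun n => ?_
    rcases hu.1.eq_or_lt with rfl | h0
    · rw [(hW n).zero, (hW (n + 1)).zero]
    · exact hVmax _ (hCgt n) _ ((hW (n + 1)).isSingularSubsolution hd (hCanti n)) u ⟨h0, hu.2⟩
  set w : ℝ → ℝ := fun u => ⨅ n, W n u with hw
  have hlim : ∀ u ∈ Ico (0 : ℝ) 1, Tendsto (fun n => W n u) atTop (𝓝 (w u)) := by
    intro u hu
    refine tendsto_atTop_ciInf (hanti u hu) ⟨0, ?_⟩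
    rintro _ ⟨n, rfl⟩
    exact hW0 n u hu
  have hw0 : ∀ u ∈ Ico (0 : ℝ) 1, 0 ≤ w u := fun u hu => le_ciInf fun n => hW0 n u hu
  obtain ⟨Kf, hKf⟩ := isCompact_Icc.exists_bound_of_continuousOn hd.continuousOn_f
  obtain ⟨Kh, hKh⟩ := isCompact_Icc.exists_bound_of_continuousOn hd.continuousOn_h
  obtain ⟨Kq, hKq⟩ := isCompact_Icc.exists_bound_of_continuousOn hd.continuousOn_q
  have hKh0 : 0 ≤ Kh := (norm_nonneg _).trans (hKh 0 ⟨le_rfl, zero_le_one⟩)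
  have hWle : ∀ n, ∀ u ∈ Ico (0 : ℝ) 1, W n u ≤ |c| + 1 + Kf := by
    intro n u hu
    have h1 := (hW n).le_linear hd hu
    have h2 := (abs_le.1 (hKf u ⟨hu.1, hu.2.le⟩)).1
    have h3 : C n * u ≤ |c| + 1 := by
      have := mul_le_mul_of_nonneg_right ((hCle n).trans (add_le_add_left (le_abs_self c) 1)) hu.1
      nlinarith [hu.2, hu.1, abs_nonneg c]
    linarith
  set B : ℝ := 2 * ((|c| + 1 + Kh) * (|c| + 1 + Kf) + Kq) with hB
  have hbound : ∀ n, ∀ s ∈ Ico (0 : ℝ) 1, ‖2 * ((C n - h s) * W n s - q s)‖ ≤ B := by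
    intro n s hs
    have hs' : s ∈ Icc (0 : ℝ) 1 := ⟨hs.1, hs.2.le⟩
    have h1 : |C n - h s| ≤ |c| + 1 + Kh := by
      have h2 : |C n| ≤ |c| + 1 := abs_le.2
        ⟨by linarith [hCgt n, neg_abs_le c], by linarith [hCle n, le_abs_self c]⟩
      exact (abs_sub _ _).trans (add_le_add h2 (hKh s hs'))
    have h3 : |(C n - h s) * W n s| ≤ (|c| + 1 + Kh) * (|c| + 1 + Kf) := by
      rw [abs_mul, abs_of_nonneg (hW0 n s hs)]
      exact mul_le_mul h1 (hWle n s hs) (hW0 n s hs) (by positivity)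
    rw [Real.norm_eq_abs, abs_mul, abs_two]
    exact mul_le_mul_of_nonneg_left ((abs_sub _ _).trans (add_le_add h3 (hKq s hs'))) two_pos.le
  have hklim : ∀ s ∈ Ico (0 : ℝ) 1, Tendsto (fun n => 2 * ((C n - h s) * W n s - q s)) atTop
      (𝓝 (2 * ((c - h s) * w s - q s))) := fun s hs =>
    tendsto_const_nhds.mul (((hClim.sub tendsto_const_nhds).mul (hlim s hs)).sub
      tendsto_const_nhds)
  have hsub : ∀ u ∈ Ioo (0 : ℝ) 1, ∀ s ∈ Ioc 0 u, s ∈ Ico (0 : ℝ) 1 :=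
    fun u hu s hs => ⟨hs.1.le, hs.2.trans_lt hu.2⟩
  have hmeasn : ∀ u ∈ Ioo (0 : ℝ) 1, ∀ n, AEStronglyMeasurable
      (fun s => 2 * ((C n - h s) * W n s - q s)) (volume.restrict (Ioc 0 u)) := by
    intro u hu n
    have hs : Ioc 0 u ⊆ Icc (0 : ℝ) 1 := fun s hs => ⟨hs.1.le, hs.2.trans hu.2.le⟩
    exact ContinuousOn.aestronglyMeasurable (continuousOn_const.mul (((continuousOn_const.sub
      (hd.continuousOn_h.mono hs)).mul ((hW n).continuousOn.mono (hsub u hu))).sub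
      (hd.continuousOn_q.mono hs))) measurableSet_Ioc
  refine ⟨w, of_integral_sq hd hw0 (fun u hu => ?_) fun u hu => ?_⟩
  · rw [intervalIntegrable_iff_integrableOn_Ioc_of_le hu.1.le]
    refine Integrable.mono' (g := fun _ => B) (integrableOn_const (by simp)) ?_ ?_
    · refine aestronglyMeasurable_of_tendsto_ae atTop (hmeasn u hu) ?_
      rw [ae_restrict_iff' measurableSet_Ioc]
      exact ae_of_all _ fun s hs => hklim s (hsub u hu s hs)
    · rw [ae_restrict_iff' measurableSet_Ioc]
      refine ae_of_all _ fun s hs => ?_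
      exact le_of_tendsto (hklim s (hsub u hu s hs)).norm
        (Eventually.of_forall fun n => hbound n s (hsub u hu s hs))
  · rcases hu.1.eq_or_lt with rfl | h0
    · simp [hw, (hW _).zero]
    have hu' : u ∈ Ioo (0 : ℝ) 1 := ⟨h0, hu.2⟩
    refine tendsto_nhds_unique ((hlim u hu).pow 2) ?_
    simp_rw [fun n => ((hW n).integral_sq hd hu').symm]
    refine intervalIntegral.tendsto_integral_filter_of_dominated_convergence
      (fun s => B) (Eventually.of_forall fun n => ?_) (Eventually.of_forall fun n => ?_)
      (by simp) ?_
    · rw [uIoc_of_le h0.le]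
      exact hmeasn u hu' n
    · refine ae_of_all _ fun s hs => ?_
      rw [uIoc_of_le h0.le] at hs
      exact hbound n s (hsub u hu' s hs)
    · refine ae_of_all _ fun s hs => ?_
      rw [uIoc_of_le h0.le] at hs
      exact hklim s (hsub u hu' s hs)

/-! ### Bounds on the admissible speeds -/

lemma div_le_speed (hw : IsSingularSolution h q c w) (hd : IsSingularData f h q) {u : ℝ}
    (hu : u ∈ Ioc (0 : ℝ) 1) : f u / u ≤ c := by
  rw [div_le_iff₀ hu.1]
  have hmem : ∀ s ∈ Ico (0 : ℝ) 1, f s ≤ c * s := by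
    intro s hs
    rcases hs.1.eq_or_lt with rfl | h0
    · simp [hd.f_zero]
    · linarith [hw.le_linear hd hs, hw.pos s ⟨h0, hs.2⟩]
  have hcl : closure (Ico (0 : ℝ) 1) = Icc 0 1 := closure_Ico zero_ne_one
  have hsub : u ∈ closure (Ico (0 : ℝ) 1) := hcl ▸ ⟨hu.1.le, hu.2⟩
  exact le_on_closure hmem (hcl ▸ hd.continuousOn_f) (continuousOn_const.mul continuousOn_id) hsub

/-- If `ℓ u ≤ q u` near `0`, then `h 0 + 2 √ℓ ≤ c`. Otherwise `p = w / u` is bounded near `0` by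
some `β < 2 √ℓ` and satisfies `u p' ≤ -(p² - β p + ℓ) / p ≤ -m / β` with `m = ℓ - β² / 4 > 0`, so
`p` would grow at least like `-(m / β) log u`. -/
lemma add_two_mul_sqrt_le_speed (hw : IsSingularSolution h q c w) (hd : IsSingularData f h q)
    {l : ℝ} (hl : 0 < l) (hql : ∀ᶠ u in 𝓝[>] (0 : ℝ), l * u ≤ q u) : h 0 + 2 * √l ≤ c := by
  by_contra! hlt
  have hsl : 0 < √l := Real.sqrt_pos.2 hl
  obtain ⟨β, hβ1, hβ2⟩ : ∃ β, max (c - h 0) 0 < β ∧ β < 2 * √l :=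
    exists_between (max_lt (by linarith) (by linarith))
  have hβ0 : 0 < β := (le_max_right _ _).trans_lt hβ1
  have hm : 0 < l - β ^ 2 / 4 := by nlinarith [Real.sq_sqrt hl.le]
  set m := l - β ^ 2 / 4 with hmdef
  have hh : ∀ᶠ u in 𝓝[>] (0 : ℝ), c - h u < β := by
    have h1 : ContinuousWithinAt h (Icc 0 1) 0 := hd.continuousOn_h 0 ⟨le_rfl, zero_le_one⟩
    have h2 : Tendsto (fun u => c - h u) (𝓝[>] 0) (𝓝 (c - h 0)) :=
      tendsto_const_nhds.sub (h1.mono_of_mem_nhdsWithin (Icc_mem_nhdsGT zero_lt_one))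
    exact h2.eventually (gt_mem_nhds ((le_max_left _ _).trans_lt hβ1))
  obtain ⟨δ, hδ0, hδ⟩ := mem_nhdsGT_iff_exists_Ioo_subset.1
    ((hql.and hh).and (Ioo_mem_nhdsGT (zero_lt_one (α := ℝ))))
  have hδ0 : 0 < δ := hδ0
  have hδ1 : ∀ u ∈ Ioo 0 δ, l * u ≤ q u := fun u hu => (hδ hu).1.1
  have hδ2 : ∀ u ∈ Ioo 0 δ, c - h u < β := fun u hu => (hδ hu).1.2
  have hδ3 : ∀ u ∈ Ioo 0 δ, u ∈ Ioo (0 : ℝ) 1 := fun u hu => (hδ hu).2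
  have hder : ∀ u ∈ Ioo 0 δ, c - h u - q u / w u ≤ β - l * u / w u := by
    intro u hu
    have := hw.pos u (hδ3 u hu)
    have := hδ1 u hu
    have h1 : l * u / w u ≤ q u / w u := by gcongr
    linarith [hδ2 u hu]
  -- integrating `w' ≤ β` gives `w u ≤ β u`
  have hwle : ∀ u ∈ Ioo 0 δ, w u ≤ β * u := by
    intro u hu
    have hanti : AntitoneOn (fun s => w s - β * s) (Ico 0 δ) := by
      have hsub : Ico 0 δ ⊆ Ico 0 1 := by
        intro s hs
        rcases hs.1.eq_or_lt with rfl | h0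
        · exact ⟨le_rfl, zero_lt_one⟩
        · exact ⟨h0.le, (hδ3 s ⟨h0, hs.2⟩).2⟩
      have hder' : ∀ s ∈ Ioo 0 δ,
          HasDerivAt (fun s => w s - β * s) (c - h s - q s / w s - β * 1) s := fun s hs =>
        (hw.hasDerivAt s (hδ3 s hs)).sub ((hasDerivAt_id s).const_mul β)
      refine antitoneOn_of_deriv_nonpos (convex_Ico 0 δ)
        ((hw.continuousOn.mono hsub).sub (continuousOn_const.mul continuousOn_id)) ?_ ?_
      · rw [interior_Ico]
        exact fun s hs => (hder' s hs).differentiableAt.differentiableWithinAt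
      · rw [interior_Ico]
        intro s hs
        rw [(hder' s hs).deriv]
        have h1 : 0 < q s / w s := div_pos (hd.q_pos s (hδ3 s hs)) (hw.pos s (hδ3 s hs))
        linarith [hδ2 s hs]
    have := hanti ⟨le_rfl, hδ0⟩ ⟨hu.1.le, hu.2⟩ hu.1.le
    simp only [hw.zero, mul_zero, sub_zero] at this
    linarith
  have hQ : AntitoneOn (fun s => w s / s + m / β * Real.log s) (Ioo 0 δ) := by
    have hder' : ∀ s ∈ Ioo 0 δ, HasDerivAt (fun s => w s / s + m / β * Real.log s)
        (((c - h s - q s / w s) * s - w s * 1) / s ^ 2 + m / β * s⁻¹) s := fun s hs =>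
      ((hw.hasDerivAt s (hδ3 s hs)).div (hasDerivAt_id s) hs.1.ne').add
        ((Real.hasDerivAt_log hs.1.ne').const_mul _)
    refine antitoneOn_of_deriv_nonpos (convex_Ioo 0 δ)
      (fun s hs => (hder' s hs).continuousAt.continuousWithinAt) ?_ ?_
    · rw [interior_Ioo]
      exact fun s hs => (hder' s hs).differentiableAt.differentiableWithinAt
    · rw [interior_Ioo]
      intro s hs
      rw [(hder' s hs).deriv]
      have hs0 := hs.1
      have hwp := hw.pos s (hδ3 s hs)
      have h1 : ((c - h s - q s / w s) * s - w s * 1) ≤ (β - l * s / w s) * s - w s := by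
        have := mul_le_mul_of_nonneg_right (hder s hs) hs0.le
        linarith
      have h2 : (β - l * s / w s) * s - w s ≤ - (m / β) * s := by
        rw [← sub_nonneg]
        have h3 : -(m / β) * s - ((β - l * s / w s) * s - w s)
            = (β * (w s - β * s / 2) ^ 2 + m * s * (β * s - w s)) / (β * w s) := by
          rw [hmdef]
          field_simp
          ring
        rw [h3]
        have h4 := hwle s hs
        have : 0 ≤ β * s - w s := by linarith
        positivity
      have h5 : ((c - h s - q s / w s) * s - w s * 1) / s ^ 2 ≤ (-(m / β) * s) / s ^ 2 := by
        gcongr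
        linarith
      have h6 : (-(m / β) * s) / s ^ 2 = - (m / β * s⁻¹) := by
        field_simp
      linarith
  have hlog : Tendsto (fun s => β + m / β * Real.log s) (𝓝[>] 0) atBot :=
    tendsto_atBot_add_const_left _ _
      (Real.tendsto_log_nhdsGT_zero.const_mul_atBot (by positivity))
  have hmid : δ / 2 ∈ Ioo 0 δ := ⟨by linarith, by linarith⟩
  obtain ⟨s, hs1, hs2⟩ := ((hlog.eventually (eventually_lt_atBot
    (w (δ / 2) / (δ / 2) + m / β * Real.log (δ / 2)))).and
    (Ioo_mem_nhdsGT hmid.1)).exists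
  have hs : s ∈ Ioo 0 δ := ⟨hs2.1, hs2.2.trans hmid.2⟩
  have h1 := hQ hs hmid hs2.2.le
  have h2 : w s / s ≤ β := by
    rw [div_le_iff₀ hs.1]
    exact hwle s hs
  simp only at h1
  linarith

end IsSingularSolution

/-- The linear function `κ u` is a subsolution as soon as `κ + M / κ ≤ c - S`. -/
lemma IsSingularSubsolution.linear {f h q : ℝ → ℝ} (hd : IsSingularData f h q) {S M κ c : ℝ}
    (hκ : 0 < κ) (hf : ∀ u ∈ Ioo (0 : ℝ) 1, f u ≤ S * u) (hq : ∀ u ∈ Ioo (0 : ℝ) 1, q u ≤ M * u)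
    (hc : κ + M / κ ≤ c - S) : IsSingularSubsolution f q c (fun u => κ * u) := by
  have hb : ∀ u ∈ Ioo (0 : ℝ) 1, q u / (κ * u) ≤ M / κ := by
    intro u hu
    have := hq u hu
    have hu0 := hu.1
    rw [div_le_div_iff₀ (by positivity) hκ]
    nlinarith
  have hint : ∀ u ∈ Ioo (0 : ℝ) 1, IntervalIntegrable (fun s => q s / (κ * s)) volume 0 u := by
    intro u hu
    have hsub : Ioc 0 u ⊆ Ioo (0 : ℝ) 1 := fun s hs => ⟨hs.1, hs.2.trans_lt hu.2⟩
    rw [intervalIntegrable_iff_integrableOn_Ioc_of_le hu.1.le]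
    refine Integrable.mono' (g := fun _ => M / κ) (integrableOn_const (by simp)) ?_ ?_
    · refine ContinuousOn.aestronglyMeasurable ?_ measurableSet_Ioc
      refine (hd.continuousOn_q.mono (hsub.trans Ioo_subset_Icc_self)).div
        (continuousOn_const.mul continuousOn_id) fun s hs => (mul_pos hκ hs.1).ne'
    · rw [ae_restrict_iff' measurableSet_Ioc]
      refine ae_of_all _ fun s hs => ?_
      rw [Real.norm_of_nonneg (div_pos (hd.q_pos s (hsub hs)) (mul_pos hκ hs.1)).le]
      exact hb s (hsub hs)
  refine ⟨fun u hu => mul_pos hκ hu.1, hint, fun u hu => ?_⟩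
  have h1 : ∫ s in (0 : ℝ)..u, q s / (κ * s) ≤ ∫ s in (0 : ℝ)..u, M / κ :=
    intervalIntegral.integral_mono_on_of_le_Ioo hu.1.le (hint u hu) (by simp)
      fun s hs => hb s ⟨hs.1, hs.2.trans hu.2⟩
  rw [intervalIntegral.integral_const, smul_eq_mul, sub_zero] at h1
  have h2 := hf u hu
  have h3 := mul_le_mul_of_nonneg_right hc hu.1.le
  nlinarith

/-! ### Weak derivatives on an open interval -/

lemma MeasureTheory.LocallyIntegrableOn.integrable_mul_of_tsupport_subset {I : Set ℝ} {u ψ : ℝ → ℝ}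
    (hu : LocallyIntegrableOn u I) (hψ : Continuous ψ) (hc : HasCompactSupport ψ)
    (hs : tsupport ψ ⊆ I) : Integrable (fun x => u x * ψ x) := by
  have h1 : IntegrableOn (fun x => u x * ψ x) (tsupport ψ) :=
    (hu.integrableOn_compact_subset hs hc).mul_continuousOn hψ.continuousOn hc
  refine (integrableOn_iff_integrable_of_support_subset fun x hx => ?_).1 h1
  exact subset_tsupport ψ fun h0 => hx (by simp [h0])

/-- Integration by parts against a test function `ψ` supported in the open set `I`: the derivative
of `N ψ` has integral zero. -/
lemma integral_mul_deriv_add_deriv_mul_eq_zero {I : Set ℝ} (hI : IsOpen I) {N N' ψ : ℝ → ℝ}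
    (hN : ∀ x ∈ I, HasDerivAt N (N' x) x) (hN' : ContinuousOn N' I) (hψ : ContDiff ℝ ∞ ψ)
    (hc : HasCompactSupport ψ) (hs : tsupport ψ ⊆ I) :
    ∫ x in I, (N' x * ψ x + N x * deriv ψ x) = 0 := by
  have hψ0 : ∀ x, x ∉ tsupport ψ → ψ =ᶠ[𝓝 x] 0 := fun x hx => notMem_tsupport_iff_eventuallyEq.1 hx
  have hdψ : Continuous (deriv ψ) := hψ.continuous_deriv (by simp)
  have hder : ∀ x, HasDerivAt (fun x => N x * ψ x) (N' x * ψ x + N x * deriv ψ x) x := by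
    intro x
    by_cases hx : x ∈ tsupport ψ
    · exact (hN x (hs hx)).mul (hψ.differentiable (by simp) x).hasDerivAt
    · have h0 := hψ0 x hx
      have h1 : (fun x => N x * ψ x) =ᶠ[𝓝 x] fun _ => 0 := by
        filter_upwards [h0] with y hy
        simp [hy]
      refine ((hasDerivAt_const x (0 : ℝ)).congr_of_eventuallyEq h1).congr_deriv ?_
      rw [h0.deriv_eq, h0.eq_of_nhds]
      simp
  have hcont : Continuous (fun x => N' x * ψ x + N x * deriv ψ x) := by
    rw [continuous_iff_continuousAt]
    intro x
    by_cases hx : x ∈ tsupport ψ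
    · exact ((hN'.continuousAt (hI.mem_nhds (hs hx))).mul hψ.continuous.continuousAt).add
        ((hN x (hs hx)).continuousAt.mul hdψ.continuousAt)
    · refine (continuousAt_const (y := (0 : ℝ))).congr ?_
      filter_upwards [hψ0 x hx, (hψ0 x hx).deriv] with y hy hy'
      simp [hy, hy']
  have hcomp : HasCompactSupport (fun x => N' x * ψ x + N x * deriv ψ x) :=
    (hc.mul_left (f := N')).add (hc.deriv.mul_left (f := N))
  rw [setIntegral_eq_integral_of_forall_compl_eq_zero]
  · exact integral_eq_zero_of_hasDerivAt_of_integrable hder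
      (hcont.integrable_of_hasCompactSupport hcomp)
      (Continuous.integrable_of_hasCompactSupport
        (continuous_iff_continuousAt.2 fun x => (hder x).continuousAt) (hc.mul_left (f := N)))
  · intro x hx
    have h0 := hψ0 x fun h => hx (hs h)
    rw [h0.deriv_eq, h0.eq_of_nhds]
    simp

/-- A test function on an open interval with vanishing integral is the derivative of a test
function on that interval. -/
lemma exists_deriv_eq_of_integral_eq_zero {I : Set ℝ} (hI : I.OrdConnected) (hne : I.Nonempty)
    {ζ : ℝ → ℝ} (hζ : ContDiff ℝ ∞ ζ) (hc : HasCompactSupport ζ) (hs : tsupport ζ ⊆ I)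
    (h0 : ∫ x, ζ x = 0) :
    ∃ ψ : ℝ → ℝ, ContDiff ℝ ∞ ψ ∧ HasCompactSupport ψ ∧ tsupport ψ ⊆ I ∧ deriv ψ = ζ := by
  obtain ⟨x₀, hx₀⟩ := hne
  set K := insert x₀ (tsupport ζ) with hK
  have hKc : IsCompact K := hc.isCompact.insert x₀
  have hKne : K.Nonempty := insert_nonempty _ _
  have hKI : K ⊆ I := insert_subset hx₀ hs
  set p := sInf K
  set r := sSup K
  have hpI : Icc p r ⊆ I := hI.out (hKI (hKc.sInf_mem hKne)) (hKI (hKc.sSup_mem hKne))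
  have hsupp : Function.support ζ ⊆ Ioo p r := by
    rw [← interior_Icc]
    refine interior_maximal (fun x hx => ?_) hζ.continuous.isOpen_support
    have : x ∈ K := mem_insert_of_mem _ (subset_tsupport ζ hx)
    exact ⟨csInf_le hKc.bddBelow this, le_csSup hKc.bddAbove this⟩
  have hζz : ∀ x, x ∉ Ioo p r → ζ x = 0 := fun x hx => by
    by_contra h
    exact hx (hsupp h)
  have hder : ∀ x, HasDerivAt (fun x => ∫ s in p..x, ζ s) (ζ x) x := fun x =>
    hζ.continuous.integral_hasStrictDerivAt p x |>.hasDerivAt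
  have hderiv : deriv (fun x => ∫ s in p..x, ζ s) = ζ := funext fun x => (hder x).deriv
  have hψsupp : Function.support (fun x => ∫ s in p..x, ζ s) ⊆ Icc p r := by
    intro x hx
    by_contra hnot
    apply hx
    rcases lt_or_ge x p with hxp | hxp
    · have : ∀ s ∈ uIcc p x, ζ s = 0 := fun s hs => hζz s fun h => by
        rw [uIcc_of_ge hxp.le] at hs
        exact absurd h.1 (not_lt.2 hs.2)
      simp only
      rw [intervalIntegral.integral_congr (g := fun _ => (0 : ℝ)) this]
      simp
    · have hxr : r < x := by
        by_contra! h
        exact hnot ⟨hxp, h⟩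
      simp only
      rw [intervalIntegral.integral_eq_integral_of_support_subset, h0]
      exact hsupp.trans fun s hs => ⟨hs.1, (hs.2.trans hxr).le⟩
  have hts : tsupport (fun x => ∫ s in p..x, ζ s) ⊆ Icc p r := closure_minimal hψsupp isClosed_Icc
  refine ⟨fun x => ∫ s in p..x, ζ s, ?_, ?_, hts.trans hpI, hderiv⟩
  · rw [contDiff_infty_iff_deriv, hderiv]
    exact ⟨fun x => (hder x).differentiableAt, hζ⟩
  · exact isCompact_Icc.of_isClosed_subset (isClosed_tsupport _) hts

/-- **du Bois-Reymond lemma**: a locally integrable function on an open interval whose weak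
derivative vanishes is almost everywhere constant. -/
lemma ae_eq_const_of_integral_mul_deriv_eq_zero {I : Set ℝ} (hI : IsOpen I) (hI' : I.OrdConnected)
    (hne : I.Nonempty) {u : ℝ → ℝ} (hu : LocallyIntegrableOn u I)
    (H : ∀ ψ : ℝ → ℝ, ContDiff ℝ ∞ ψ → HasCompactSupport ψ → tsupport ψ ⊆ I →
      ∫ x, u x * deriv ψ x = 0) :
    ∃ C, ∀ᵐ x, x ∈ I → u x = C := by
  obtain ⟨x₀, hx₀⟩ := id hne
  obtain ⟨ε, hε, hball⟩ := Metric.nhds_basis_closedBall.mem_iff.1 (hI.mem_nhds hx₀)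
  let b : ContDiffBump x₀ := ⟨ε / 2, ε, by positivity, by linarith⟩
  set η₀ : ℝ → ℝ := b.normed volume with hη₀
  have hη₀d : ContDiff ℝ ∞ η₀ := b.contDiff_normed
  have hη₀c : HasCompactSupport η₀ := b.hasCompactSupport_normed
  have hη₀s : tsupport η₀ ⊆ I := by
    rw [hη₀, b.tsupport_normed_eq]
    exact hball
  have hη₀i : ∫ x, η₀ x = 1 := b.integral_normed
  set C := ∫ x, u x * η₀ x
  refine ⟨C, ?_⟩
  have hconst : LocallyIntegrableOn (fun _ : ℝ => C) I :=
    (locallyIntegrable_const C).locallyIntegrableOn I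
  have := hI.ae_eq_zero_of_integral_contDiff_smul_eq_zero (μ := volume)
    (f := fun x => u x - C) (hu.sub hconst) ?_
  · filter_upwards [this] with x hx hxI
    linarith [hx hxI]
  · intro η hηd hηc hηs
    set m := ∫ x, η x
    have hηi : Integrable η := hηd.continuous.integrable_of_hasCompactSupport hηc
    have hη₀int : Integrable η₀ := hη₀d.continuous.integrable_of_hasCompactSupport hη₀c
    set ζ : ℝ → ℝ := fun x => η x - m * η₀ x with hζ
    have hζ0 : ∫ x, ζ x = 0 := by
      rw [hζ, integral_sub hηi (hη₀int.const_mul m), integral_const_mul, hη₀i]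
      simp [m]
    have hmc : HasCompactSupport fun x => m * η₀ x := hη₀c.mul_left (f := fun _ => m)
    have hζs : tsupport ζ ⊆ I := by
      refine (tsupport_sub η fun x => m * η₀ x).trans (union_subset hηs ?_)
      exact (closure_mono fun x hx => right_ne_zero_of_mul hx).trans hη₀s
    obtain ⟨ψ, hψ1, hψ2, hψ3, hψ4⟩ := exists_deriv_eq_of_integral_eq_zero hI' hne
      (hηd.sub (contDiff_const.mul hη₀d)) (hηc.sub hmc) hζs hζ0
    have h1 := H ψ hψ1 hψ2 hψ3
    have hi1 := hu.integrable_mul_of_tsupport_subset hηd.continuous hηc hηs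
    have hi2 := hu.integrable_mul_of_tsupport_subset hη₀d.continuous hη₀c hη₀s
    have h2 : ∫ x, u x * η x - m * (u x * η₀ x) = 0 := by
      rw [← h1]
      refine integral_congr_ae (ae_of_all _ fun x => ?_)
      simp only [hψ4]
      ring
    rw [integral_sub hi1 (hi2.const_mul m), integral_const_mul] at h2
    have h3 : (fun x => η x • (u x - C)) = fun x => u x * η x - C * η x := by
      funext x
      simp only [smul_eq_mul]
      ring
    rw [h3, integral_sub hi1 (hηi.const_mul C), integral_const_mul]
    linarith

/-! ### Regularity of wave profiles -/

lemma hasDerivAt_primitive_comp {D φ : ℝ → ℝ} {I : Set ℝ} (hD : ContinuousOn D (Icc 0 1))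
    (hI : IsOpen I) (hφ : MapsTo φ I (Icc 0 1)) {φ' ξ : ℝ} (hξ : ξ ∈ I)
    (hd : HasDerivAt φ φ' ξ) :
    HasDerivAt (fun ξ => ∫ s in (0 : ℝ)..φ ξ, D s) (D (φ ξ) * φ') ξ := by
  have hu := hφ hξ
  have h1 : HasDerivWithinAt (fun u => ∫ s in (0 : ℝ)..u, D s) (D (φ ξ)) (Icc 0 1) (φ ξ) := by
    have : Fact (φ ξ ∈ Icc (0 : ℝ) 1) := ⟨hu⟩
    refine intervalIntegral.integral_hasDerivWithinAt_right
      ((hD.mono (Icc_subset_Icc_right hu.2)).intervalIntegrable_of_Icc hu.1)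
      (hD.stronglyMeasurableAtFilter_nhdsWithin measurableSet_Icc _) (hD _ hu)
  exact (h1.comp ξ hd.hasDerivWithinAt hφ).hasDerivAt (hI.mem_nhds hξ)

/-- The flux `D(φ) φ'` of a profile agrees almost everywhere with a continuous function `z`, which
is the classical derivative of `∫₀^φ D`, and the equation `(z - f(φ) + c φ)' = - g(φ)` holds in the
classical sense. -/
lemma IsTravelingWaveProfile.exists_flux {f D g φ : ℝ → ℝ} {I : Set ℝ} {c : ℝ}
    (hφ : IsTravelingWaveProfile f D g I c φ) (hf : ContinuousOn f (Icc 0 1))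
    (hD : ContinuousOn D (Icc 0 1)) (hg : ContinuousOn g (Icc 0 1)) :
    ∃ z : ℝ → ℝ, ContinuousOn z I ∧
      (∀ ξ ∈ I, HasDerivAt (fun ξ => ∫ s in (0 : ℝ)..φ ξ, D s) (z ξ) ξ) ∧
      ∀ ξ ∈ I, HasDerivAt (fun ξ => z ξ - f (φ ξ) + c * φ ξ) (-g (φ ξ)) ξ := by
  have hI := hφ.isOpen
  obtain ⟨x₀, hx₀⟩ := id hφ.nonempty
  have hfφ : ContinuousOn (fun ξ => f (φ ξ)) I := hf.comp hφ.continuousOn hφ.mapsTo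
  have hgφ : ContinuousOn (fun ξ => g (φ ξ)) I := hg.comp hφ.continuousOn hφ.mapsTo
  have hcφ : ContinuousOn (fun ξ => c * φ ξ) I := continuousOn_const.mul hφ.continuousOn
  have hsubI : ∀ x ∈ I, uIcc x₀ x ⊆ I := fun x hx => hφ.ordConnected.uIcc_subset hx₀ hx
  have hprim : ∀ {k : ℝ → ℝ}, ContinuousOn k I → ∀ x ∈ I,
      HasDerivAt (fun x => ∫ s in x₀..x, k s) (k x) x := fun hk x hx =>
    intervalIntegral.integral_hasDerivAt_right ((hk.mono (hsubI x hx)).intervalIntegrable)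
      (hk.stronglyMeasurableAtFilter hI x hx) (hk.continuousAt (hI.mem_nhds hx))
  set N : ℝ → ℝ := fun x => ∫ s in x₀..x, g (φ s) with hN
  have hNd : ∀ x ∈ I, HasDerivAt N (g (φ x)) x := hprim hgφ
  have hNc : ContinuousOn N I := fun x hx => (hNd x hx).continuousAt.continuousWithinAt
  have hloc : ∀ {k : ℝ → ℝ}, ContinuousOn k I → LocallyIntegrableOn k I := fun hk =>
    hk.locallyIntegrableOn hI.measurableSet
  set Φ : ℝ → ℝ := fun ξ => D (φ ξ) * deriv φ ξ with hΦ
  have hG : LocallyIntegrableOn (fun ξ => Φ ξ - f (φ ξ) + c * φ ξ) I :=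
    (hφ.locallyIntegrableOn.sub (hloc hfφ)).add (hloc hcφ)
  obtain ⟨C, hC⟩ := ae_eq_const_of_integral_mul_deriv_eq_zero hI hφ.ordConnected hφ.nonempty
    (u := fun ξ => Φ ξ - f (φ ξ) + c * φ ξ + N ξ) (hG.add (hloc hNc)) fun ψ h1 h2 h3 => by
      have hdψ : Continuous (deriv ψ) := h1.continuous_deriv (by simp)
      have h3' : tsupport (deriv ψ) ⊆ I := tsupport_deriv_subset.trans h3
      have hw := hφ.weak_equation ψ h1 h2 h3
      have hp := integral_mul_deriv_add_deriv_mul_eq_zero hI hNd hgφ h1 h2 h3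
      have hi1 := hG.integrable_mul_of_tsupport_subset hdψ h2.deriv h3'
      have hi2 := (hloc hNc).integrable_mul_of_tsupport_subset hdψ h2.deriv h3'
      have hi3 := (hloc hgφ).integrable_mul_of_tsupport_subset h1.continuous h2 h3
      rw [integral_sub hi1.integrableOn hi3.integrableOn] at hw
      rw [integral_add hi3.integrableOn hi2.integrableOn] at hp
      have h4 : ∀ x, x ∉ I → deriv ψ x = 0 := fun x hx =>
        image_eq_zero_of_notMem_tsupport fun h => hx (h3' h)
      rw [← setIntegral_eq_integral_of_forall_compl_eq_zero (s := I)]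
      · simp_rw [add_mul _ (N _)]
        rw [integral_add hi1.integrableOn hi2.integrableOn]
        linarith
      · intro x hx
        rw [h4 x hx, mul_zero]
  set z : ℝ → ℝ := fun ξ => C - N ξ + f (φ ξ) - c * φ ξ with hz
  have hzc : ContinuousOn z I := ((continuousOn_const.sub hNc).add hfφ).sub hcφ
  have hzΦ : ∀ᵐ x, x ∈ I → Φ x = z x := by
    filter_upwards [hC] with x hx hxI
    have := hx hxI
    simp only [hz]
    linarith
  refine ⟨z, hzc, fun ξ hξ => ?_, fun ξ hξ => ?_⟩
  · set P : ℝ → ℝ := fun ξ => ∫ s in (0 : ℝ)..φ ξ, D s with hP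
    have hderivP : ∀ᵐ x, x ∈ I → deriv P x = z x := by
      filter_upwards [hzΦ, (ae_restrict_iff' hI.measurableSet).1 hφ.ae_differentiableAt]
        with x hx1 hx2 hxI
      rw [← hx1 hxI]
      exact (hasDerivAt_primitive_comp hD hI hφ.mapsTo hxI (hx2 hxI).hasDerivAt).deriv
    have hPeq : ∀ x ∈ I, P x = P x₀ + ∫ s in x₀..x, z s := by
      intro x hx
      have h1 := (hφ.locallyAbsolutelyContinuousOn x₀ x (hsubI x hx)).integral_deriv_eq_sub
      rw [intervalIntegral.integral_congr_ae (g := z)] at h1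
      · linarith
      · filter_upwards [hderivP] with s hs hsm
        exact hs (hsubI x hx (uIoc_subset_uIcc hsm))
    refine ((hprim hzc ξ hξ).const_add (P x₀)).congr_of_eventuallyEq ?_
    filter_upwards [hI.mem_nhds hξ] with x hx
    exact hPeq x hx
  · have : (fun ξ => z ξ - f (φ ξ) + c * φ ξ) = fun ξ => C - N ξ := by
      funext ξ
      simp only [hz]
      ring
    rw [this]
    exact (hNd ξ hξ).const_sub C

/-! ### Flux identities -/

/-- Standing assumptions on the coefficients `f`, `D`, `g` of the equation, with `h = f'`. -/
structure IsWaveData (f h D g : ℝ → ℝ) : Prop extends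
    IsSingularData f h (fun u => D u * g u) where
  continuousOn_D : ContinuousOn D (Icc 0 1)
  D_pos : ∀ u ∈ Ioo (0 : ℝ) 1, 0 < D u
  continuousOn_g : ContinuousOn g (Icc 0 1)
  g_pos : ∀ u ∈ Ioc (0 : ℝ) 1, 0 < g u
  g_zero : g 0 = 0

namespace IsWaveData

variable {f h D g : ℝ → ℝ}

lemma D_nonneg (hd : IsWaveData f h D g) : ∀ u ∈ Icc (0 : ℝ) 1, 0 ≤ D u := by
  have hcl : closure (Ioo (0 : ℝ) 1) = Icc 0 1 := closure_Ioo zero_ne_one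
  intro u hu
  exact le_on_closure (fun v hv => (hd.D_pos v hv).le) continuousOn_const
    (hcl ▸ hd.continuousOn_D) (hcl ▸ hu)

lemma g_nonneg (hd : IsWaveData f h D g) : ∀ u ∈ Icc (0 : ℝ) 1, 0 ≤ g u := by
  intro u hu
  rcases hu.1.eq_or_lt with rfl | h0
  · exact hd.g_zero.ge
  · exact (hd.g_pos u ⟨h0, hu.2⟩).le

lemma primitive_nonneg (hd : IsWaveData f h D g) {u : ℝ} (hu : u ∈ Icc (0 : ℝ) 1) :
    0 ≤ ∫ s in (0 : ℝ)..u, D s :=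
  intervalIntegral.integral_nonneg hu.1 fun s hs => hd.D_nonneg s ⟨hs.1, hs.2.trans hu.2⟩

lemma continuousOn_primitive (hd : IsWaveData f h D g) :
    ContinuousOn (fun u => ∫ s in (0 : ℝ)..u, D s) (Icc 0 1) := by
  have := intervalIntegral.continuousOn_primitive_interval'
    (hd.continuousOn_D.intervalIntegrable_of_Icc zero_le_one) (μ := volume) left_mem_uIcc
  rwa [uIcc_of_le zero_le_one] at this

end IsWaveData

/-- `z` is the flux `D(φ) φ'` of a continuous function `φ` on the open interval `I`, and the wave
equation `(z - f(φ) + c φ)' = - g(φ)` holds in the classical sense. -/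
structure IsFlux (f D g : ℝ → ℝ) (I : Set ℝ) (c : ℝ) (φ z : ℝ → ℝ) : Prop where
  isOpen : IsOpen I
  ordConnected : I.OrdConnected
  continuousOn_profile : ContinuousOn φ I
  mapsTo : MapsTo φ I (Icc 0 1)
  continuousOn : ContinuousOn z I
  hasDerivAt_primitive : ∀ ξ ∈ I, HasDerivAt (fun ξ => ∫ s in (0 : ℝ)..φ ξ, D s) (z ξ) ξ
  hasDerivAt_balance : ∀ ξ ∈ I, HasDerivAt (fun ξ => z ξ - f (φ ξ) + c * φ ξ) (-g (φ ξ)) ξ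

lemma IsTravelingWaveProfile.exists_isFlux {f h D g φ : ℝ → ℝ} {I : Set ℝ} {c : ℝ}
    (hφ : IsTravelingWaveProfile f D g I c φ) (hd : IsWaveData f h D g) :
    ∃ z, IsFlux f D g I c φ z := by
  obtain ⟨z, h1, h2, h3⟩ := hφ.exists_flux hd.continuousOn_f hd.continuousOn_D hd.continuousOn_g
  exact ⟨z, hφ.isOpen, hφ.ordConnected, hφ.continuousOn, hφ.mapsTo, h1, h2, h3⟩

namespace IsFlux

variable {f h D g φ z : ℝ → ℝ} {I : Set ℝ} {c : ℝ}

lemma antitoneOn_balance (hz : IsFlux f D g I c φ z) (hd : IsWaveData f h D g) :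
    AntitoneOn (fun ξ => z ξ - f (φ ξ) + c * φ ξ) I := by
  refine antitoneOn_of_deriv_nonpos hz.ordConnected.convex
    (fun ξ hξ => (hz.hasDerivAt_balance ξ hξ).continuousAt.continuousWithinAt) ?_ ?_
  · rw [hz.isOpen.interior_eq]
    exact fun ξ hξ => (hz.hasDerivAt_balance ξ hξ).differentiableAt.differentiableWithinAt
  · rw [hz.isOpen.interior_eq]
    intro ξ hξ
    rw [(hz.hasDerivAt_balance ξ hξ).deriv]
    linarith [hd.g_nonneg _ (hz.mapsTo hξ)]

/-- If `φ → 0` at `+∞`, then `z - f(φ) + c φ ≥ 0`: this quantity is nonincreasing, and it comes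
arbitrarily close to `0` at arbitrarily large points, because by the mean value theorem so does
the derivative `z` of the convergent function `∫₀^φ D`. -/
lemma balance_nonneg (hz : IsFlux f D g I c φ z) (hd : IsWaveData f h D g) {a : ℝ}
    (ha : Ioi a ⊆ I) (hlim : Tendsto φ atTop (𝓝 0)) {ξ : ℝ} (hξ : ξ ∈ I) :
    0 ≤ z ξ - f (φ ξ) + c * φ ξ := by
  set P : ℝ → ℝ := fun ξ => ∫ s in (0 : ℝ)..φ ξ, D s with hP
  have hlim' : Tendsto φ atTop (𝓝[Icc 0 1] 0) := by
    refine tendsto_nhdsWithin_iff.2 ⟨hlim, ?_⟩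
    filter_upwards [Ioi_mem_atTop a] with x hx
    exact hz.mapsTo (ha hx)
  have h0 : (0 : ℝ) ∈ Icc (0 : ℝ) 1 := ⟨le_rfl, zero_le_one⟩
  have hPlim : Tendsto P atTop (𝓝 0) := by
    have := (hd.continuousOn_primitive 0 h0).tendsto.comp hlim'
    rwa [intervalIntegral.integral_same] at this
  have hdiff : Tendsto (fun x => P (x + 1) - P x) atTop (𝓝 0) := by
    simpa using (hPlim.comp (tendsto_atTop_add_const_right atTop 1 tendsto_id)).sub hPlim
  have hmvt : ∀ x, ∃ y, a < x → y ∈ Ioo x (x + 1) ∧ z y = P (x + 1) - P x := by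
    intro x
    by_cases hx : a < x
    · have hsub : ∀ y ∈ Icc x (x + 1), y ∈ I := fun y hy => ha (hx.trans_le hy.1)
      obtain ⟨y, hy1, hy2⟩ := exists_hasDerivAt_eq_slope P z (by linarith : x < x + 1)
        (fun y hy => (hz.hasDerivAt_primitive y (hsub y hy)).continuousAt.continuousWithinAt)
        (fun y hy => hz.hasDerivAt_primitive y (hsub y ⟨hy.1.le, hy.2.le⟩))
      exact ⟨y, fun _ => ⟨hy1, by simpa using hy2⟩⟩
    · exact ⟨0, fun h => absurd h hx⟩
  choose y hy using hmvt
  have hyI : ∀ᶠ x in atTop, y x ∈ Ioo x (x + 1) ∧ z (y x) = P (x + 1) - P x := by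
    filter_upwards [Ioi_mem_atTop a] with x hx
    exact hy x hx
  have hytop : Tendsto y atTop atTop :=
    tendsto_atTop_mono' atTop (hyI.mono fun x hx => hx.1.1.le) tendsto_id
  have hfy : Tendsto (fun x => f (φ (y x))) atTop (𝓝 0) := by
    have := ((hd.continuousOn_f 0 h0).tendsto.comp hlim').comp hytop
    rwa [hd.f_zero] at this
  have hzy : Tendsto (fun x => z (y x)) atTop (𝓝 0) :=
    hdiff.congr' (hyI.mono fun x hx => hx.2.symm)
  have htot : Tendsto (fun x => z (y x) - f (φ (y x)) + c * φ (y x)) atTop (𝓝 0) := by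
    simpa using (hzy.sub hfy).add ((hlim.comp hytop).const_mul c)
  refine le_of_tendsto htot ?_
  filter_upwards [hytop.eventually (eventually_gt_atTop (max a ξ))] with x hx
  exact hz.antitoneOn_balance hd hξ (ha ((le_max_left _ _).trans_lt hx))
    ((le_max_right _ _).trans_lt hx).le

lemma hasDerivAt_profile (hz : IsFlux f D g I c φ z) (hd : IsWaveData f h D g) {ξ : ℝ}
    (hξ : ξ ∈ I) (hφ : φ ξ ∈ Ioo (0 : ℝ) 1) : HasDerivAt φ (z ξ / D (φ ξ)) ξ := by
  have hcφ : ContinuousAt φ ξ := hz.continuousOn_profile.continuousAt (hz.isOpen.mem_nhds hξ)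
  have hDo : ContinuousOn D (Ioo 0 1) := hd.continuousOn_D.mono Ioo_subset_Icc_self
  have hP : HasDerivAt (fun u => ∫ s in (0 : ℝ)..u, D s) (D (φ ξ)) (φ ξ) :=
    intervalIntegral.integral_hasDerivAt_right
      ((hd.continuousOn_D.mono (Icc_subset_Icc_right hφ.2.le)).intervalIntegrable_of_Icc hφ.1.le)
      (hDo.stronglyMeasurableAtFilter isOpen_Ioo _ hφ) (hDo.continuousAt (isOpen_Ioo.mem_nhds hφ))
  exact HasDerivAt.of_comp_left hcφ hP (hz.hasDerivAt_primitive ξ hξ) (hd.D_pos _ hφ).ne'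
    (Eventually.of_forall fun x => rfl)

lemma hasDerivAt_flux (hz : IsFlux f D g I c φ z) (hd : IsWaveData f h D g) {ξ : ℝ}
    (hξ : ξ ∈ I) (hφ : φ ξ ∈ Ioo (0 : ℝ) 1) :
    HasDerivAt z (-g (φ ξ) + (h (φ ξ) - c) * (z ξ / D (φ ξ))) ξ := by
  have h1 := hz.hasDerivAt_profile hd hξ hφ
  have h2 := ((hz.hasDerivAt_balance ξ hξ).add ((hd.hasDerivAt_f _ hφ).comp ξ h1)).sub
    (h1.const_mul c)
  refine (h2.congr_of_eventuallyEq (Eventually.of_forall fun x => ?_)).congr_deriv (by ring)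
  simp only [Pi.sub_apply, Pi.add_apply, Function.comp_apply]
  ring

/-- A nonincreasing profile has negative flux wherever `0 < φ < 1`: at a zero of the nonpositive
function `z` one would have `z' = 0`, but the equation gives `z' = - g(φ) < 0`. -/
lemma flux_neg (hz : IsFlux f D g I c φ z) (hd : IsWaveData f h D g) (hanti : AntitoneOn φ I)
    {ξ : ℝ} (hξ : ξ ∈ I) (hφ : φ ξ ∈ Ioo (0 : ℝ) 1) : z ξ < 0 := by
  have hle : ∀ x ∈ I, φ x ∈ Ioo (0 : ℝ) 1 → z x ≤ 0 := by
    intro x hx hφx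
    have h1 : derivWithin φ I x ≤ 0 := hanti.derivWithin_nonpos
    rw [derivWithin_of_isOpen hz.isOpen hx, (hz.hasDerivAt_profile hd hx hφx).deriv] at h1
    by_contra! h2
    exact absurd h1 (not_le.2 (div_pos h2 (hd.D_pos _ hφx)))
  refine (hle ξ hξ hφ).lt_of_ne fun h0 => ?_
  have hmax : IsLocalMax z ξ := by
    have hcφ : ContinuousAt φ ξ := hz.continuousOn_profile.continuousAt (hz.isOpen.mem_nhds hξ)
    filter_upwards [hz.isOpen.mem_nhds hξ, hcφ (isOpen_Ioo.mem_nhds hφ)] with x hx hφx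
    rw [h0]
    exact hle x hx hφx
  have h1 := hmax.hasDerivAt_eq_zero (hz.hasDerivAt_flux hd hξ hφ)
  rw [h0, zero_div, mul_zero, add_zero] at h1
  linarith [hd.g_pos _ ⟨hφ.1, hφ.2.le⟩]

/-- A nonzero profile tending to `0` at `+∞` cannot be defined on all of `ℝ`. Towards `-∞` the
quantity `z - f(φ) + c φ` increases and is bounded below by some `m > 0`, while its decay rate
`g(φ)` controls `c φ - f(φ)` up to `m / 2`; hence it grows at least linearly, so `z` becomes large
and `∫₀^φ D` would be negative somewhere. -/
lemma not_univ (hz : IsFlux f D g univ c φ z) (hd : IsWaveData f h D g)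
    (hlim : Tendsto φ atTop (𝓝 0)) {ξ₁ : ℝ} (hφ : 0 < φ ξ₁) : False := by
  set F : ℝ → ℝ := fun ξ => z ξ - f (φ ξ) + c * φ ξ with hF
  set P : ℝ → ℝ := fun ξ => ∫ s in (0 : ℝ)..φ ξ, D s with hP
  have hmem : ∀ ξ, φ ξ ∈ Icc (0 : ℝ) 1 := fun ξ => hz.mapsTo (mem_univ ξ)
  have hF0 : ∀ ξ, 0 ≤ F ξ := fun ξ =>
    hz.balance_nonneg hd (subset_univ (Ioi 0)) hlim (mem_univ ξ)
  have hFd : ∀ ξ, HasDerivAt F (-g (φ ξ)) ξ := fun ξ => hz.hasDerivAt_balance ξ (mem_univ ξ)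
  have hPd : ∀ ξ, HasDerivAt P (z ξ) ξ := fun ξ => hz.hasDerivAt_primitive ξ (mem_univ ξ)
  have hP0 : ∀ ξ, 0 ≤ P ξ := fun ξ => hd.primitive_nonneg (hmem ξ)
  have hFanti : ∀ x y, x ≤ y → F y ≤ F x := fun x y hxy =>
    hz.antitoneOn_balance hd (mem_univ x) (mem_univ y) hxy
  have hm : 0 < F ξ₁ := by
    refine (hF0 ξ₁).lt_of_ne fun h0 => ?_
    have hmin : IsLocalMin F ξ₁ := Eventually.of_forall fun x => h0 ▸ hF0 x
    have := hmin.hasDerivAt_eq_zero (hFd ξ₁)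
    linarith [hd.g_pos _ ⟨hφ, (hmem ξ₁).2⟩]
  set m := F ξ₁ with hmdef
  set k : ℝ → ℝ := fun u => c * u - f u with hk
  have hkc : ContinuousOn k (Icc 0 1) :=
    (continuousOn_const.mul continuousOn_id).sub hd.continuousOn_f
  obtain ⟨B, hB⟩ := isCompact_Icc.exists_bound_of_continuousOn hkc
  have h0mem : (0 : ℝ) ∈ Icc (0 : ℝ) 1 := ⟨le_rfl, zero_le_one⟩
  have hB0 : 0 ≤ B := (norm_nonneg _).trans (hB 0 h0mem)
  have hkB : ∀ u ∈ Icc (0 : ℝ) 1, k u ≤ B := fun u hu => (le_abs_self _).trans (hB u hu)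
  obtain ⟨K, hK0, hK⟩ : ∃ K, 0 ≤ K ∧ ∀ u ∈ Icc (0 : ℝ) 1, k u ≤ m / 2 + K * g u := by
    have h1 : ∀ᶠ u in 𝓝[Icc 0 1] (0 : ℝ), k u < m / 2 := by
      refine (hkc 0 h0mem).tendsto.eventually (gt_mem_nhds ?_)
      simp only [hk, mul_zero, hd.f_zero, sub_zero]
      positivity
    obtain ⟨δ, hδ, hδ'⟩ := Metric.mem_nhdsWithin_iff.1 h1
    have hsub : Icc (min δ 1) 1 ⊆ Ioc (0 : ℝ) 1 := fun u hu =>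
      ⟨(lt_min hδ one_pos).trans_le hu.1, hu.2⟩
    obtain ⟨u₀, hu₀, hmin⟩ := (isCompact_Icc (a := min δ 1) (b := (1 : ℝ))).exists_isMinOn
      ⟨1, min_le_right _ _, le_rfl⟩ (hd.continuousOn_g.mono (hsub.trans Ioc_subset_Icc_self))
    have hg0 : 0 < g u₀ := hd.g_pos u₀ (hsub hu₀)
    refine ⟨B / g u₀, by positivity, fun u hu => ?_⟩
    rcases lt_or_ge u (min δ 1) with hlt | hge
    · have h2 : k u < m / 2 := hδ' ⟨by
        rw [Metric.mem_ball, dist_zero_right, Real.norm_of_nonneg hu.1]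
        exact hlt.trans_le (min_le_left _ _), hu⟩
      have h3 : 0 ≤ B / g u₀ * g u := mul_nonneg (by positivity) (hd.g_nonneg u hu)
      linarith
    · have h2 : g u₀ ≤ g u := hmin ⟨hge, hu.2⟩
      have h3 : B ≤ B / g u₀ * g u := by
        rw [div_mul_eq_mul_div, le_div_iff₀ hg0]
        gcongr
      linarith [hkB u hu]
  have hzF : ∀ ξ, z ξ = F ξ - k (φ ξ) := fun ξ => by
    simp only [hF, hk]
    ring
  -- `(P - K F)' = z + K g(φ) ≥ m / 2` to the left of `ξ₁`
  have hQ : MonotoneOn (fun ξ => P ξ - K * F ξ - m / 2 * ξ) (Iic ξ₁) := by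
    have hder : ∀ ξ, HasDerivAt (fun ξ => P ξ - K * F ξ - m / 2 * ξ)
        (z ξ - K * (-g (φ ξ)) - m / 2 * 1) ξ := fun ξ =>
      ((hPd ξ).sub ((hFd ξ).const_mul K)).sub ((hasDerivAt_id ξ).const_mul _)
    refine monotoneOn_of_deriv_nonneg (convex_Iic ξ₁)
      (fun ξ _ => (hder ξ).continuousAt.continuousWithinAt)
      (fun ξ _ => (hder ξ).differentiableAt.differentiableWithinAt) fun ξ hξ => ?_
    rw [interior_Iic] at hξ
    rw [(hder ξ).deriv, hzF ξ]
    linarith [hK _ (hmem ξ), hFanti ξ ξ₁ hξ.le]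
  obtain ⟨ξ₂, hξ₂, hF2⟩ : ∃ ξ₂ ≤ ξ₁, B + 1 ≤ F ξ₂ := by
    by_contra! hcon
    set q₁ := P ξ₁ - K * F ξ₁ - m / 2 * ξ₁ with hq₁
    set ξ := min ξ₁ (-2 / m * (q₁ + K * (B + 1) + 1)) with hξ
    have h1 : ξ ≤ ξ₁ := min_le_left _ _
    have h2 := hQ h1 self_mem_Iic h1
    have h3 := hcon ξ h1
    have h4 : ξ ≤ -2 / m * (q₁ + K * (B + 1) + 1) := min_le_right _ _
    have h5 : m / 2 * ξ ≤ -(q₁ + K * (B + 1) + 1) := by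
      refine (mul_le_mul_of_nonneg_left h4 (by positivity)).trans_eq ?_
      field_simp
    have h6 : K * F ξ ≤ K * (B + 1) := mul_le_mul_of_nonneg_left h3.le hK0
    simp only at h2
    linarith [hP0 ξ]
  have hP1 : MonotoneOn (fun ξ => P ξ - ξ) (Iic ξ₂) := by
    have hder : ∀ ξ, HasDerivAt (fun ξ => P ξ - ξ) (z ξ - 1) ξ := fun ξ =>
      (hPd ξ).sub (hasDerivAt_id ξ)
    refine monotoneOn_of_deriv_nonneg (convex_Iic ξ₂)
      (fun ξ _ => (hder ξ).continuousAt.continuousWithinAt)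
      (fun ξ _ => (hder ξ).differentiableAt.differentiableWithinAt) fun ξ hξ => ?_
    rw [interior_Iic] at hξ
    rw [(hder ξ).deriv, hzF ξ]
    linarith [hkB _ (hmem ξ), hFanti ξ ξ₂ hξ.le]
  have hle : ξ₂ - (P ξ₂ + 1) ≤ ξ₂ := by linarith [hP0 ξ₂]
  have := hP1 hle self_mem_Iic hle
  simp only at this
  linarith [hP0 (ξ₂ - (P ξ₂ + 1))]

end IsFlux

/-! ### From a profile to a solution of the singular problem -/

lemma antitoneOn_of_tendsto_one_zero {φ : ℝ → ℝ} {a : ℝ}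
    (hmono : MonotoneOn φ (Ioi a) ∨ AntitoneOn φ (Ioi a)) (h0 : Tendsto φ atTop (𝓝 0))
    (h1 : Tendsto φ (𝓝[>] a) (𝓝 1)) : AntitoneOn φ (Ioi a) := by
  refine hmono.resolve_left fun hm => ?_
  obtain ⟨x, hx, hxa⟩ := ((h1.eventually (lt_mem_nhds (by norm_num : (1 / 2 : ℝ) < 1))).and
    self_mem_nhdsWithin).exists
  obtain ⟨y, hy, hyx⟩ := ((h0.eventually (gt_mem_nhds (by norm_num : (0 : ℝ) < 1 / 2))).and
    (eventually_ge_atTop x)).exists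
  have hxa : a < x := hxa
  linarith [hm hxa (hxa.trans_le hyx) hyx]

/-- On the set where `0 < φ < 1`, a nonincreasing profile from `1` to `0` has a differentiable
inverse `X`, and `w u = - z (X u)` solves the singular problem. -/
lemma IsFlux.exists_isSingularSolution {f h D g φ z : ℝ → ℝ} {a c : ℝ}
    (hz : IsFlux f D g (Ioi a) c φ z) (hd : IsWaveData f h D g) (hanti : AntitoneOn φ (Ioi a))
    (h0 : Tendsto φ atTop (𝓝 0)) (h1 : Tendsto φ (𝓝[>] a) (𝓝 1)) :
    ∃ w, IsSingularSolution h (fun u => D u * g u) c w := by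
  have hex : ∀ u ∈ Ioo (0 : ℝ) 1, ∃ ξ ∈ Ioi a, φ ξ = u := by
    intro u hu
    obtain ⟨x, hx, hxa⟩ := ((h1.eventually (lt_mem_nhds hu.2)).and self_mem_nhdsWithin).exists
    obtain ⟨y, hy, hya⟩ := ((h0.eventually (gt_mem_nhds hu.1)).and (Ioi_mem_atTop a)).exists
    exact isPreconnected_Ioi.intermediate_value hya hxa hz.continuousOn_profile ⟨hy.le, hx.le⟩
  choose! X hXa hX using hex
  have hXmem : ∀ u ∈ Ioo (0 : ℝ) 1, φ (X u) ∈ Ioo (0 : ℝ) 1 := fun u hu => (hX u hu).symm ▸ hu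
  have hXanti : ∀ u ∈ Ioo (0 : ℝ) 1, ∀ v ∈ Ioo (0 : ℝ) 1, u < v → X v < X u := by
    intro u hu v hv huv
    by_contra! hle
    have := hanti (hXa u hu) (hXa v hv) hle
    rw [hX u hu, hX v hv] at this
    exact absurd huv (not_lt.2 this)
  have hneg : ∀ ξ ∈ Ioi a, φ ξ ∈ Ioo (0 : ℝ) 1 → z ξ / D (φ ξ) < 0 := fun ξ hξ hφ =>
    div_neg_of_neg_of_pos (hz.flux_neg hd hanti hξ hφ) (hd.D_pos _ hφ)
  have hinj : ∀ x ∈ Ioi a, ∀ y ∈ Ioi a, φ x ∈ Ioo (0 : ℝ) 1 → φ x = φ y → ¬ x < y := by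
    intro x hx y hy hφx hxy hlt
    have hconst : ∀ s ∈ Icc x y, φ s = φ x := fun s hs => by
      have hs' : s ∈ Ioi a := lt_of_lt_of_le hx hs.1
      exact le_antisymm (hanti hx hs' hs.1) (hxy ▸ hanti hs' hy hs.2)
    have hm : (x + y) / 2 ∈ Ioo x y := ⟨by linarith, by linarith⟩
    have hma : (x + y) / 2 ∈ Ioi a := lt_trans hx hm.1
    have hφm : φ ((x + y) / 2) ∈ Ioo (0 : ℝ) 1 := by
      rw [hconst _ (Ioo_subset_Icc_self hm)]
      exact hφx
    have hder := hz.hasDerivAt_profile hd hma hφm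
    have hder0 : HasDerivAt φ 0 ((x + y) / 2) := by
      refine (hasDerivAt_const _ (φ x)).congr_of_eventuallyEq ?_
      filter_upwards [isOpen_Ioo.mem_nhds hm] with s hs
      exact hconst s (Ioo_subset_Icc_self hs)
    exact (hneg _ hma hφm).ne (hder.unique hder0)
  have hXφ : ∀ ξ ∈ Ioi a, φ ξ ∈ Ioo (0 : ℝ) 1 → X (φ ξ) = ξ := by
    intro ξ hξ hφ
    have h2 := hX _ hφ
    have h3 := hXa _ hφ
    exact le_antisymm (not_lt.1 (hinj ξ hξ _ h3 hφ h2.symm))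
      (not_lt.1 (hinj _ h3 ξ hξ (h2.symm ▸ hφ) h2))
  have hXc : ∀ u ∈ Ioo (0 : ℝ) 1, ContinuousAt X u := by
    intro u hu
    have hmono : StrictMonoOn (fun v => -X v) (Ioo 0 1) := fun v hv v' hv' hlt =>
      neg_lt_neg (hXanti v hv v' hv' hlt)
    have himg : (fun v => -X v) '' Ioo 0 1 ∈ 𝓝 (-X u) := by
      have hcont : ContinuousAt φ (X u) :=
        hz.continuousOn_profile.continuousAt (Ioi_mem_nhds (hXa u hu))
      have h2 : ∀ᶠ ξ in 𝓝 (X u), ξ ∈ Ioi a ∧ φ ξ ∈ Ioo (0 : ℝ) 1 :=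
        (show ∀ᶠ ξ in 𝓝 (X u), ξ ∈ Ioi a from Ioi_mem_nhds (hXa u hu)).and
          (hcont (isOpen_Ioo.mem_nhds (hXmem u hu)))
      have h3 : Tendsto (fun y : ℝ => -y) (𝓝 (-X u)) (𝓝 (X u)) := by
        simpa using (continuous_neg.tendsto (-X u))
      filter_upwards [h3.eventually h2] with y hy
      exact ⟨φ (-y), hy.2, by simp [hXφ _ hy.1 hy.2]⟩
    have h4 : ContinuousAt (fun v => - -X v) u :=
      (hmono.continuousAt_of_image_mem_nhds (isOpen_Ioo.mem_nhds hu) himg).neg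
    simp only [neg_neg] at h4
    exact h4
  have hXd : ∀ u ∈ Ioo (0 : ℝ) 1, HasDerivAt X (z (X u) / D u)⁻¹ u := by
    intro u hu
    have h2 := hz.hasDerivAt_profile hd (hXa u hu) (hXmem u hu)
    have h3 := (hneg _ (hXa u hu) (hXmem u hu)).ne
    rw [hX u hu] at h2 h3
    refine h2.of_local_left_inverse (hXc u hu) h3 ?_
    filter_upwards [isOpen_Ioo.mem_nhds hu] with v hv
    exact hX v hv
  have hzneg : ∀ u ∈ Ioo (0 : ℝ) 1, z (X u) < 0 := fun u hu =>
    hz.flux_neg hd hanti (hXa u hu) (hXmem u hu)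
  set w : ℝ → ℝ := fun u => if u = 0 then 0 else -z (X u) with hw
  have hwX : ∀ u ∈ Ioo (0 : ℝ) 1, w u = -z (X u) := fun u hu => if_neg hu.1.ne'
  have hw0 : w 0 = 0 := if_pos rfl
  have hwpos : ∀ u ∈ Ioo (0 : ℝ) 1, 0 < w u := fun u hu => by
    rw [hwX u hu]
    linarith [hzneg u hu]
  have hwd : ∀ u ∈ Ioo (0 : ℝ) 1, HasDerivAt w (c - h u - D u * g u / w u) u := by
    intro u hu
    have h2 := ((hz.hasDerivAt_flux hd (hXa u hu) (hXmem u hu)).comp u (hXd u hu)).neg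
    refine (h2.congr_of_eventuallyEq ?_).congr_deriv ?_
    · filter_upwards [isOpen_Ioo.mem_nhds hu] with v hv
      exact hwX v hv
    · rw [hX u hu, hwX u hu]
      have h3 := (hzneg u hu).ne
      have h4 := (hd.D_pos u hu).ne'
      field_simp
      ring
  refine ⟨w, fun u hu => ?_, hw0, hwpos, hwd⟩
  rcases hu.1.eq_or_lt with rfl | hu0
  · -- near `0` the bounds `0 ≤ w u ≤ c u - f u` squeeze `w`
    have hb : ∀ u ∈ Ico (0 : ℝ) 1, 0 ≤ w u ∧ w u ≤ c * u - f u := by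
      intro u hu
      rcases hu.1.eq_or_lt with rfl | hu0
      · simp [hw0, hd.f_zero]
      · have hu' : u ∈ Ioo (0 : ℝ) 1 := ⟨hu0, hu.2⟩
        have := hz.balance_nonneg hd Subset.rfl h0 (hXa u hu')
        rw [hX u hu'] at this
        exact ⟨(hwpos u hu').le, by rw [hwX u hu']; linarith⟩
    have hup : Tendsto (fun u => c * u - f u) (𝓝[Ico 0 1] 0) (𝓝 0) := by
      have hc : ContinuousOn (fun u => c * u - f u) (Ico 0 1) :=
        (continuousOn_const.mul continuousOn_id).sub (hd.continuousOn_f.mono Ico_subset_Icc_self)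
      have := (hc 0 hu).tendsto
      simpa [hd.f_zero] using this
    have := tendsto_of_tendsto_of_tendsto_of_le_of_le' tendsto_const_nhds hup
      (eventually_nhdsWithin_of_forall fun u hu => (hb u hu).1)
      (eventually_nhdsWithin_of_forall fun u hu => (hb u hu).2)
    rw [ContinuousWithinAt, hw0]
    exact this
  · exact (hwd u ⟨hu0, hu.2⟩).continuousAt.continuousWithinAt

/-! ### From a solution of the singular problem to a profile -/

/-- A continuous function on an open interval that has the continuous derivative `k` off one point
has derivative `k` at that point as well. -/
lemma hasDerivAt_of_forall_ne {I : Set ℝ} (hI : IsOpen I) (hI' : I.OrdConnected) {F k : ℝ → ℝ}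
    {b : ℝ} (hF : ContinuousOn F I) (hk : ContinuousOn k I)
    (hd : ∀ x ∈ I, x ≠ b → HasDerivAt F (k x) x) : ∀ x ∈ I, HasDerivAt F (k x) x := by
  intro x hx
  have hint : ∀ y ∈ I, IntervalIntegrable k volume x y := fun y hy =>
    (hk.mono (hI'.uIcc_subset hx hy)).intervalIntegrable
  have hFeq : ∀ y ∈ I, F y = F x + ∫ s in x..y, k s := by
    intro y hy
    have hsub := hI'.uIcc_subset hx hy
    rw [integral_eq_of_hasDerivAt_off_countable F k (countable_singleton b) (hF.mono hsub)
      (fun s hs => hd s (hsub (Ioo_subset_Icc_self hs.1)) hs.2) (hint y hy)]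
    ring
  have hprim : HasDerivAt (fun y => ∫ s in x..y, k s) (k x) x :=
    intervalIntegral.integral_hasDerivAt_right (hint x hx) (hk.stronglyMeasurableAtFilter hI x hx)
      (hk.continuousAt (hI.mem_nhds hx))
  refine (hprim.const_add (F x)).congr_of_eventuallyEq ?_
  filter_upwards [hI.mem_nhds hx] with y hy
  exact hFeq y hy

/-- The generalized inverse of a strictly decreasing continuous `Ξ : (0,1) → ℝ` that is bounded
below: with `a = inf Ξ`, it is `sInf {u ∈ (0,1) | Ξ u ≤ x}` for `x > a`, hence it vanishes for
`x ≥ sup Ξ`. The point `b` separates the points where it is positive from those where it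
vanishes. -/
lemma exists_continuous_inverse_extended_by_zero {Ξ : ℝ → ℝ} (hanti : StrictAntiOn Ξ (Ioo 0 1))
    (hcont : ContinuousOn Ξ (Ioo 0 1)) (hbdd : BddBelow (Ξ '' Ioo 0 1)) :
    ∃ (a b : ℝ) (φ : ℝ → ℝ), AntitoneOn φ (Ioi a) ∧ ContinuousOn φ (Ioi a) ∧
      MapsTo φ (Ioi a) (Ico 0 1) ∧ (∀ u ∈ Ioo (0 : ℝ) 1, a < Ξ u ∧ φ (Ξ u) = u) ∧
      Tendsto φ atTop (𝓝 0) ∧ Tendsto φ (𝓝[>] a) (𝓝 1) ∧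
      ∀ x ∈ Ioi a, x ≠ b →
        (φ x ∈ Ioo (0 : ℝ) 1 ∧ ∀ᶠ y in 𝓝 x, Ξ (φ y) = y) ∨ φ =ᶠ[𝓝 x] 0 := by
  have hhalf : (1 / 2 : ℝ) ∈ Ioo (0 : ℝ) 1 := by norm_num
  have hne : (Ξ '' Ioo 0 1).Nonempty := ⟨_, mem_image_of_mem _ hhalf⟩
  set a := sInf (Ξ '' Ioo 0 1) with ha
  set S : ℝ → Set ℝ := fun x => {u | u ∈ Ioo (0 : ℝ) 1 ∧ Ξ u ≤ x} with hS
  set φ : ℝ → ℝ := fun x => sInf (S x) with hφ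
  have haΞ : ∀ u ∈ Ioo (0 : ℝ) 1, a < Ξ u := by
    intro u hu
    obtain ⟨v, hv1, hv2⟩ := exists_between hu.2
    have hv : v ∈ Ioo (0 : ℝ) 1 := ⟨hu.1.trans hv1, hv2⟩
    exact (csInf_le hbdd (mem_image_of_mem Ξ hv)).trans_lt (hanti hu hv hv1)
  have hSne : ∀ x ∈ Ioi a, ∃ u, u ∈ S x := by
    intro x hx
    obtain ⟨_, ⟨u, hu, rfl⟩, hux⟩ := exists_lt_of_csInf_lt hne hx
    exact ⟨u, hu, hux.le⟩
  have hSbdd : ∀ x, BddBelow (S x) := fun x => ⟨0, fun u hu => hu.1.1.le⟩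
  have hφle : ∀ x, ∀ u ∈ S x, φ x ≤ u := fun x u hu => csInf_le (hSbdd x) hu
  have hφanti : AntitoneOn φ (Ioi a) := fun x hx y _ hxy =>
    csInf_le_csInf (hSbdd y) (hSne x hx) fun u hu => ⟨hu.1, hu.2.trans hxy⟩
  have hφmem : MapsTo φ (Ioi a) (Ico 0 1) := by
    intro x hx
    obtain ⟨u, hu⟩ := hSne x hx
    exact ⟨le_csInf ⟨u, hu⟩ fun v hv => hv.1.1.le, (hφle x u hu).trans_lt hu.1.2⟩
  have hφΞ : ∀ u ∈ Ioo (0 : ℝ) 1, φ (Ξ u) = u := by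
    intro u hu
    refine IsLeast.csInf_eq ⟨⟨hu, le_rfl⟩, fun v hv => ?_⟩
    exact (hanti.le_iff_ge hv.1 hu).1 hv.2
  have hφcont : ∀ x ∈ Ioi a, ContinuousAt φ x := by
    intro x hx
    refine tendsto_order.2 ⟨fun l hl => ?_, fun r hr => ?_⟩
    · rcases lt_or_ge l 0 with hl0 | hl0
      · filter_upwards [Ioi_mem_nhds hx] with y hy
        exact hl0.trans_le (hφmem hy).1
      · obtain ⟨v, hv1, hv2⟩ := exists_between hl
        have hv : v ∈ Ioo (0 : ℝ) 1 := ⟨hl0.trans_lt hv1, hv2.trans (hφmem hx).2⟩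
        have hxv : x < Ξ v := by
          by_contra! h
          exact absurd hv2 (not_lt.2 (hφle x v ⟨hv, h⟩))
        filter_upwards [Ioi_mem_nhds hx, Iio_mem_nhds hxv] with y hy1 hy2
        have := hφanti hy1 (haΞ v hv) (le_of_lt hy2)
        rw [hφΞ v hv] at this
        exact hv1.trans_le this
    · obtain ⟨v, hv, hvr⟩ := exists_lt_of_csInf_lt (hSne x hx) hr
      obtain ⟨v', hv1, hv2⟩ := exists_between (lt_min hvr hv.1.2)
      have hv' : v' ∈ Ioo (0 : ℝ) 1 := ⟨hv.1.1.trans hv1, hv2.trans_le (min_le_right _ _)⟩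
      have hlt : Ξ v' < x := (hanti hv.1 hv' hv1).trans_le hv.2
      filter_upwards [Ioi_mem_nhds hlt] with y hy
      exact (hφle y v' ⟨hv', le_of_lt hy⟩).trans_lt (hv2.trans_le (min_le_left _ _))
  have hΞφ : ∀ x ∈ Ioi a, 0 < φ x → Ξ (φ x) = x := by
    intro x hx hpos
    obtain ⟨u, hu⟩ := hSne x hx
    obtain ⟨v, hv, hxv⟩ : ∃ v ∈ Ioo (0 : ℝ) 1, x ≤ Ξ v := by
      by_contra! hcon
      obtain ⟨v, hv1, hv2⟩ := exists_between hpos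
      have hv : v ∈ Ioo (0 : ℝ) 1 := ⟨hv1, hv2.trans (hφmem hx).2⟩
      exact absurd hv2 (not_lt.2 (hφle x v ⟨hv, (hcon v hv).le⟩))
    obtain ⟨s, hs, rfl⟩ := isPreconnected_Ioo.intermediate_value hu.1 hv hcont ⟨hu.2, hxv⟩
    rw [hφΞ s hs]
  obtain ⟨b, hb1, hb2⟩ : ∃ b, (∀ x ∈ Ioi a, x < b → 0 < φ x) ∧
      ∀ x ∈ Ioi a, b < x → φ =ᶠ[𝓝 x] 0 ∨ 0 < φ x := by
    set Z := {x | x ∈ Ioi a ∧ φ x = 0} with hZ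
    have hZb : BddBelow Z := ⟨a, fun x hx => le_of_lt hx.1⟩
    rcases Z.eq_empty_or_nonempty with hempty | hZne
    · refine ⟨a, fun x hx hxa => absurd hx (not_lt.2 hxa.le), fun x hx _ => Or.inr ?_⟩
      refine (hφmem hx).1.lt_of_ne fun h0 => ?_
      have : x ∈ Z := ⟨hx, h0.symm⟩
      simp [hempty] at this
    · refine ⟨sInf Z, fun x hx hxb => ?_, fun x hx hxb => Or.inl ?_⟩
      · refine (hφmem hx).1.lt_of_ne fun h0 => ?_
        exact absurd hxb (not_lt.2 (csInf_le hZb ⟨hx, h0.symm⟩))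
      · obtain ⟨y, hy, hyx⟩ := exists_lt_of_csInf_lt hZne hxb
        filter_upwards [Ioi_mem_nhds hyx] with s hs
        have hsa : s ∈ Ioi a := lt_trans (mem_Ioi.1 hy.1) (mem_Ioi.1 hs)
        have := hφanti hy.1 hsa (le_of_lt hs)
        rw [hy.2] at this
        exact le_antisymm this (hφmem hsa).1
  refine ⟨a, b, φ, hφanti, fun x hx => (hφcont x hx).continuousWithinAt, hφmem,
    fun u hu => ⟨haΞ u hu, hφΞ u hu⟩, ?_, ?_, fun x hx hxb => ?_⟩
  · refine tendsto_order.2 ⟨fun l hl => ?_, fun r hr => ?_⟩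
    · filter_upwards [Ioi_mem_atTop a] with y hy
      exact hl.trans_le (hφmem hy).1
    · obtain ⟨v, hv1, hv2⟩ := exists_between (lt_min hr one_pos)
      have hv : v ∈ Ioo (0 : ℝ) 1 := ⟨hv1, hv2.trans_le (min_le_right _ _)⟩
      filter_upwards [eventually_ge_atTop (Ξ v)] with y hy
      exact (hφle y v ⟨hv, hy⟩).trans_lt (hv2.trans_le (min_le_left _ _))
  · refine tendsto_order.2 ⟨fun l hl => ?_, fun r hr => ?_⟩
    · obtain ⟨v, hv1, hv2⟩ := exists_between (max_lt hl zero_lt_one)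
      have hv : v ∈ Ioo (0 : ℝ) 1 := ⟨(le_max_right _ _).trans_lt hv1, hv2⟩
      filter_upwards [Ioo_mem_nhdsGT (haΞ v hv)] with y hy
      have := hφanti hy.1 (haΞ v hv) hy.2.le
      rw [hφΞ v hv] at this
      exact ((le_max_left _ _).trans_lt hv1).trans_le this
    · filter_upwards [self_mem_nhdsWithin] with y hy
      exact (hφmem hy).2.trans hr
  · have hpos : 0 < φ x → (φ x ∈ Ioo (0 : ℝ) 1 ∧ ∀ᶠ y in 𝓝 x, Ξ (φ y) = y) ∨ φ =ᶠ[𝓝 x] 0 := by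
      intro h0
      refine Or.inl ⟨⟨h0, (hφmem hx).2⟩, ?_⟩
      filter_upwards [Ioi_mem_nhds hx, hφcont x hx (Ioi_mem_nhds h0)] with y hy1 hy2
      exact hΞφ y hy1 hy2
    rcases lt_or_gt_of_ne hxb with hlt | hgt
    · exact hpos (hb1 x hx hlt)
    · exact (hb2 x hx hgt).elim Or.inr hpos

/-- The wave coordinate `Ξ u = ∫_u^{1/2} D / w` as a function of the profile value `u`. It stays
bounded as `u → 1`, because there `D / w` is controlled by `D g / w`, the derivative of the bounded
function `c u - f u - w u`. -/
lemma IsSingularSolution.exists_wave_coordinate {f h D g w : ℝ → ℝ} {c : ℝ}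
    (hw : IsSingularSolution h (fun u => D u * g u) c w) (hd : IsWaveData f h D g) :
    ∃ Ξ : ℝ → ℝ, (∀ u ∈ Ioo (0 : ℝ) 1, HasDerivAt Ξ (-(D u / w u)) u) ∧
      StrictAntiOn Ξ (Ioo 0 1) ∧ BddBelow (Ξ '' Ioo 0 1) := by
  have hkc : ContinuousOn (fun u => D u / w u) (Ioo 0 1) :=
    (hd.continuousOn_D.mono Ioo_subset_Icc_self).div (hw.continuousOn.mono Ioo_subset_Ico_self)
      fun u hu => (hw.pos u hu).ne'
  have hkpos : ∀ u ∈ Ioo (0 : ℝ) 1, 0 < D u / w u := fun u hu =>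
    div_pos (hd.D_pos u hu) (hw.pos u hu)
  have hhalf : (1 / 2 : ℝ) ∈ Ioo (0 : ℝ) 1 := by norm_num
  set Ξ : ℝ → ℝ := fun u => -∫ s in (1 / 2 : ℝ)..u, D s / w s with hΞ
  have hΞd : ∀ u ∈ Ioo (0 : ℝ) 1, HasDerivAt Ξ (-(D u / w u)) u := fun u hu =>
    (intervalIntegral.integral_hasDerivAt_right
      (hkc.mono (ordConnected_Ioo.uIcc_subset hhalf hu)).intervalIntegrable
      (hkc.stronglyMeasurableAtFilter isOpen_Ioo u hu)
      (hkc.continuousAt (isOpen_Ioo.mem_nhds hu))).neg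
  have hΞanti : StrictAntiOn Ξ (Ioo 0 1) := by
    refine strictAntiOn_of_deriv_neg (convex_Ioo 0 1)
      (fun u hu => (hΞd u hu).continuousAt.continuousWithinAt) fun u hu => ?_
    rw [interior_Ioo] at hu
    rw [(hΞd u hu).deriv]
    linarith [hkpos u hu]
  refine ⟨Ξ, hΞd, hΞanti, ?_⟩
  have hsub : Icc (1 / 2 : ℝ) 1 ⊆ Ioc 0 1 := fun u hu => ⟨by linarith [hu.1], hu.2⟩
  obtain ⟨u₀, hu₀, hmin⟩ := (isCompact_Icc (a := (1 / 2 : ℝ)) (b := 1)).exists_isMinOn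
    ⟨1, by norm_num, le_rfl⟩ (hd.continuousOn_g.mono (hsub.trans Ioc_subset_Icc_self))
  have hg0 : 0 < g u₀ := hd.g_pos u₀ (hsub hu₀)
  have hsub' : ∀ u ∈ Ico (1 / 2 : ℝ) 1, u ∈ Ioo (0 : ℝ) 1 := fun u hu =>
    ⟨by linarith [hu.1], hu.2⟩
  have hmono : MonotoneOn (fun u => Ξ u + (c * u - f u - w u) / g u₀) (Ico (1 / 2) 1) := by
    have hder : ∀ u ∈ Ioo (0 : ℝ) 1, HasDerivAt (fun u => Ξ u + (c * u - f u - w u) / g u₀)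
        (-(D u / w u) + D u * g u / w u / g u₀) u := fun u hu =>
      (hΞd u hu).add ((hw.hasDerivAt_gap hd.toIsSingularData hu).div_const _)
    refine monotoneOn_of_deriv_nonneg (convex_Ico _ _)
      (fun u hu => (hder u (hsub' u hu)).continuousAt.continuousWithinAt)
      (fun u hu => (hder u (hsub' u (interior_subset hu))).differentiableAt.differentiableWithinAt)
      fun u hu => ?_
    have hu' := interior_subset hu
    have hu1 := hsub' u hu'
    rw [(hder u hu1).deriv]
    have h1 : g u₀ ≤ g u := hmin ⟨hu'.1, hu'.2.le⟩
    have h2 := hkpos u hu1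
    have h3 : D u * g u / w u / g u₀ = D u / w u * (g u / g u₀) := by ring
    have h4 : 1 ≤ g u / g u₀ := (one_le_div hg0).2 h1
    rw [h3]
    nlinarith
  obtain ⟨B, hB⟩ := isCompact_Icc.exists_bound_of_continuousOn (f := fun u => c * u - f u)
    ((continuousOn_const.mul continuousOn_id).sub hd.continuousOn_f)
  have hΞhalf : Ξ (1 / 2) = 0 := by simp [hΞ]
  set L := min 0 ((c * (1 / 2) - f (1 / 2) - w (1 / 2)) / g u₀ - B / g u₀) with hL
  refine ⟨L, ?_⟩
  rintro _ ⟨u, hu, rfl⟩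
  rcases le_total u (1 / 2) with hle | hge
  · have := hΞanti.antitoneOn hu hhalf hle
    rw [hΞhalf] at this
    exact (min_le_left _ _).trans this
  · have h1 := hmono ⟨le_rfl, hhalf.2⟩ ⟨hge, hu.2⟩ hge
    simp only [hΞhalf, zero_add] at h1
    have h2 : (c * u - f u - w u) / g u₀ ≤ B / g u₀ := by
      have h3 := (le_abs_self _).trans (hB u ⟨hu.1.le, hu.2.le⟩)
      have h4 := hw.pos u hu
      gcongr
      linarith
    exact (min_le_right _ _).trans (by linarith)

/-- Every solution of the singular problem comes from a semi-wavefront from `1` to `0`. -/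
lemma IsSingularSolution.exists_isSemiWavefrontToZero {f h D g w : ℝ → ℝ} {c : ℝ}
    (hw : IsSingularSolution h (fun u => D u * g u) c w) (hd : IsWaveData f h D g) :
    ∃ (a : ℝ) (φ : ℝ → ℝ), IsSemiWavefrontToZero f D g a c φ ∧ Tendsto φ (𝓝[>] a) (𝓝 1) := by
  obtain ⟨Ξ, hΞd, hΞanti, hΞb⟩ := hw.exists_wave_coordinate hd
  obtain ⟨a, b, φ, hanti, hcont, hmaps, hΞ, hlim0, hlim1, hcases⟩ :=
    exists_continuous_inverse_extended_by_zero hΞanti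
      (fun u hu => (hΞd u hu).continuousAt.continuousWithinAt) hΞb
  have hmaps' : MapsTo φ (Ioi a) (Icc 0 1) := fun x hx => Ico_subset_Icc_self (hmaps hx)
  set z : ℝ → ℝ := fun x => -w (φ x) with hz
  have hzc : ContinuousOn z (Ioi a) := (hw.continuousOn.comp hcont hmaps).neg
  have hφd : ∀ x ∈ Ioi a, φ x ∈ Ioo (0 : ℝ) 1 → (∀ᶠ y in 𝓝 x, Ξ (φ y) = y) →
      HasDerivAt φ (-(D (φ x) / w (φ x)))⁻¹ x := fun x hx h1 h2 =>
    (hΞd _ h1).of_local_left_inverse (hcont.continuousAt (Ioi_mem_nhds hx))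
      (neg_ne_zero.2 (div_pos (hd.D_pos _ h1) (hw.pos _ h1)).ne') h2
  have hdiff : ∀ x ∈ Ioi a, x ≠ b → HasDerivAt φ (deriv φ x) x ∧ D (φ x) * deriv φ x = z x := by
    intro x hx hxb
    rcases hcases x hx hxb with ⟨h1, h2⟩ | h0
    · have h3 := hφd x hx h1 h2
      refine ⟨h3.differentiableAt.hasDerivAt, ?_⟩
      rw [h3.deriv]
      have h4 := (hd.D_pos _ h1).ne'
      have h5 := (hw.pos _ h1).ne'
      simp only [hz]
      field_simp
    · have h3 : HasDerivAt φ 0 x := (hasDerivAt_const x (0 : ℝ)).congr_of_eventuallyEq h0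
      refine ⟨h3.differentiableAt.hasDerivAt, ?_⟩
      simp [h3.deriv, hz, h0.eq_of_nhds, hw.zero]
  have hae : ∀ᵐ x ∂(volume.restrict (Ioi a)), x ≠ b ∧ x ∈ Ioi a :=
    (ae_restrict_of_ae (Measure.ae_ne volume b)).and (ae_restrict_mem measurableSet_Ioi)
  have hPd : ∀ x ∈ Ioi a, HasDerivAt (fun x => ∫ s in (0 : ℝ)..φ x, D s) (z x) x := by
    refine hasDerivAt_of_forall_ne isOpen_Ioi ordConnected_Ioi (b := b)
      (hd.continuousOn_primitive.comp hcont hmaps') hzc fun x hx hxb => ?_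
    obtain ⟨h1, h2⟩ := hdiff x hx hxb
    exact h2 ▸ hasDerivAt_primitive_comp hd.continuousOn_D isOpen_Ioi hmaps' hx h1
  have hfφ : ContinuousOn (fun x => f (φ x)) (Ioi a) := hd.continuousOn_f.comp hcont hmaps'
  have hgφ : ContinuousOn (fun x => g (φ x)) (Ioi a) := hd.continuousOn_g.comp hcont hmaps'
  have hNc : ContinuousOn (fun x => z x - f (φ x) + c * φ x) (Ioi a) :=
    (hzc.sub hfφ).add (continuousOn_const.mul hcont)
  have hNd : ∀ x ∈ Ioi a, HasDerivAt (fun x => z x - f (φ x) + c * φ x) (-g (φ x)) x := by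
    refine hasDerivAt_of_forall_ne isOpen_Ioi ordConnected_Ioi (b := b) hNc hgφ.neg
      fun x hx hxb => ?_
    rcases hcases x hx hxb with ⟨h1, h2⟩ | h0
    · have h3 := (hw.hasDerivAt_gap hd.toIsSingularData h1).comp x (hφd x hx h1 h2)
      refine (h3.congr_of_eventuallyEq (Eventually.of_forall fun y => ?_)).congr_deriv ?_
      · simp only [hz, Function.comp_apply]
        ring
      · have h4 := (hd.D_pos _ h1).ne'
        have h5 := (hw.pos _ h1).ne'
        field_simp
    · have h3 : (fun x => z x - f (φ x) + c * φ x) =ᶠ[𝓝 x] fun _ => 0 := by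
        filter_upwards [h0] with y hy
        simp [hz, hy, hw.zero, hd.f_zero]
      refine ((hasDerivAt_const x (0 : ℝ)).congr_of_eventuallyEq h3).congr_deriv ?_
      simp [h0.eq_of_nhds, hd.g_zero]
  refine ⟨a, φ, ⟨?_, Or.inr hanti, ?_, hlim0⟩, hlim1⟩
  · refine ⟨isOpen_Ioi, ordConnected_Ioi, nonempty_Ioi, hcont, hmaps', ?_, ?_, ?_, ?_⟩
    · filter_upwards [hae] with x hx
      exact (hdiff x hx.2 hx.1).1.differentiableAt
    · rw [locallyIntegrableOn_iff isOpen_Ioi.isLocallyClosed]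
      intro K hK hKc
      refine ((hzc.mono hK).integrableOn_compact hKc).congr_fun_ae ?_
      filter_upwards [ae_restrict_of_ae_restrict_of_subset hK hae] with x hx
      exact (hdiff x hx.2 hx.1).2.symm
    · intro x y hxy
      have hC1 : ContDiffOn ℝ (0 + 1) (fun x => ∫ s in (0 : ℝ)..φ x, D s) (Ioi a) := by
        rw [contDiffOn_succ_iff_deriv_of_isOpen isOpen_Ioi]
        refine ⟨fun x hx => (hPd x hx).differentiableAt.differentiableWithinAt, by simp, ?_⟩
        rw [contDiffOn_zero]
        exact hzc.congr fun x hx => (hPd x hx).deriv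
      rw [zero_add] at hC1
      exact (hC1.mono hxy).absolutelyContinuousOnInterval
    · intro ψ h1 h2 h3
      rw [← integral_mul_deriv_add_deriv_mul_eq_zero isOpen_Ioi hNd hgφ.neg h1 h2 h3]
      refine integral_congr_ae ?_
      filter_upwards [hae] with x hx
      rw [(hdiff x hx.2 hx.1).2]
      ring
  · have h1 : (1 / 2 : ℝ) ∈ Ioo (0 : ℝ) 1 := by norm_num
    have h2 : (1 / 3 : ℝ) ∈ Ioo (0 : ℝ) 1 := by norm_num
    refine ⟨Ξ (1 / 2), (hΞ _ h1).1, Ξ (1 / 3), (hΞ _ h2).1, ?_⟩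
    rw [(hΞ _ h1).2, (hΞ _ h2).2]
    norm_num

/-! ### The threshold speed -/

/-- Semi-wavefronts from `1` to `0` with speed `c` correspond to solutions of the singular problem
with speed `c`; their strictness is automatic. -/
lemma IsWaveData.exists_isStrictSemiWavefrontOneZero_iff {f h D g : ℝ → ℝ}
    (hd : IsWaveData f h D g) (c : ℝ) :
    (∃ (a : ℝ) (φ : ℝ → ℝ), IsStrictSemiWavefrontOneZero f D g a c φ) ↔
      ∃ w, IsSingularSolution h (fun u => D u * g u) c w := by
  constructor
  · rintro ⟨a, φ, hφ, -, hlim1⟩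
    obtain ⟨z, hz⟩ := hφ.isTravelingWaveProfile.exists_isFlux hd
    exact hz.exists_isSingularSolution hd
      (antitoneOn_of_tendsto_one_zero hφ.monotonic hφ.tendsto_atTop hlim1) hφ.tendsto_atTop hlim1
  · rintro ⟨w, hw⟩
    obtain ⟨a, φ, hφ, hlim1⟩ := hw.exists_isSemiWavefrontToZero hd
    refine ⟨a, φ, hφ, ⟨fun h => ?_, ?_⟩, hlim1⟩
    · exact lt_irrefl a (h.symm ▸ mem_univ a : a ∈ Ioi a)
    · rintro ⟨φ₁, hφ₁, heq⟩
      obtain ⟨z, hz⟩ := hφ₁.exists_isFlux hd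
      obtain ⟨x, hx, hxa⟩ := ((hlim1.eventually (lt_mem_nhds zero_lt_one)).and
        self_mem_nhdsWithin).exists
      refine hz.not_univ hd (hφ.tendsto_atTop.congr' ?_) (ξ₁ := x) (by rwa [heq hxa])
      filter_upwards [Ioi_mem_atTop a] with y hy
      exact (heq hy).symm

/-- The admissible speeds of the singular problem form a closed half-line as soon as there is one
of them. -/
lemma IsSingularData.exists_threshold {f h q : ℝ → ℝ} (hd : IsSingularData f h q) {c₀ : ℝ}
    (h₀ : ∃ w, IsSingularSolution h q c₀ w) :
    ∃ cstar ≤ c₀, ∀ c, (∃ w, IsSingularSolution h q c w) ↔ cstar ≤ c := by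
  set A := {c | ∃ w, IsSingularSolution h q c w} with hA
  have hup : ∀ c ∈ A, ∀ c', c ≤ c' → c' ∈ A := by
    rintro c ⟨w, hw⟩ c' hcc'
    obtain ⟨w', hw', -⟩ := (hw.isSingularSubsolution hd hcc').exists_maximal_solution hd
    exact ⟨w', hw'⟩
  have hbdd : BddBelow A := by
    refine ⟨f 1 / 1, ?_⟩
    rintro c ⟨w, hw⟩
    exact hw.div_le_speed hd ⟨one_pos, le_rfl⟩
  have hmem : sInf A ∈ A := IsSingularSolution.exists_of_forall_gt hd fun c' hc' => by
    obtain ⟨c, hc, hcc'⟩ := exists_lt_of_csInf_lt ⟨c₀, h₀⟩ hc'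
    exact hup c hc c' hcc'.le
  exact ⟨sInf A, csInf_le hbdd h₀, fun c => ⟨fun hc => csInf_le hbdd hc, fun hc => hup _ hmem c hc⟩⟩

lemma IsSingularData.bddAbove_f_div {f h q : ℝ → ℝ} (hd : IsSingularData f h q) :
    BddAbove ((fun u : ℝ => f u / u) '' Ioc 0 1) := by
  obtain ⟨K, hK⟩ := isCompact_Icc.exists_bound_of_continuousOn hd.continuousOn_h
  refine ⟨K, ?_⟩
  rintro _ ⟨u, hu, rfl⟩
  obtain ⟨v, hv, hv'⟩ := exists_hasDerivAt_eq_slope f h hu.1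
    (hd.continuousOn_f.mono (Icc_subset_Icc_right hu.2))
    (fun v hv => hd.hasDerivAt_f v ⟨hv.1, hv.2.trans_le hu.2⟩)
  rw [hd.f_zero, sub_zero, sub_zero] at hv'
  simp only
  rw [← hv']
  exact (le_abs_self _).trans (hK v ⟨hv.1.le, hv.2.le.trans hu.2⟩)

lemma IsSingularData.bddAbove_q_div {f h q : ℝ → ℝ} (hd : IsSingularData f h q)
    (hlim : limsup (fun u : ℝ => ((q u / u : ℝ) : EReal)) (𝓝[>] 0) < ⊤) :
    BddAbove ((fun u : ℝ => q u / u) '' Ioc 0 1) := by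
  obtain ⟨r, hr, -⟩ := EReal.lt_iff_exists_real_btwn.1 hlim
  have hev : ∀ᶠ u in 𝓝[>] (0 : ℝ), q u / u < r :=
    (eventually_lt_of_limsup_lt hr).mono fun u hu => EReal.coe_lt_coe_iff.1 hu
  obtain ⟨δ, hδ, hδ'⟩ := mem_nhdsGT_iff_exists_Ioo_subset.1 hev
  have hδ : 0 < δ := hδ
  obtain ⟨K, hK⟩ := isCompact_Icc.exists_bound_of_continuousOn hd.continuousOn_q
  have hK0 : 0 ≤ K := (norm_nonneg _).trans (hK 0 ⟨le_rfl, zero_le_one⟩)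
  refine ⟨max r (K / δ), ?_⟩
  rintro _ ⟨u, hu, rfl⟩
  rcases lt_or_ge u δ with h1 | h1
  · exact (le_of_lt (hδ' ⟨hu.1, h1⟩)).trans (le_max_left _ _)
  · refine le_trans ?_ (le_max_right _ _)
    exact div_le_div₀ hK0 ((le_abs_self _).trans (hK u ⟨hu.1.le, hu.2⟩)) hδ h1

/-- The speed `2 √(sup q / u) + sup (f / u)` is admissible. -/
lemma IsSingularData.exists_isSingularSolution {f h q : ℝ → ℝ} (hd : IsSingularData f h q)
    (hq : BddAbove ((fun u : ℝ => q u / u) '' Ioc 0 1)) :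
    ∃ w, IsSingularSolution h q (2 * √(sSup ((fun u : ℝ => q u / u) '' Ioc 0 1)) +
      sSup ((fun u : ℝ => f u / u) '' Ioc 0 1)) w := by
  set M := sSup ((fun u : ℝ => q u / u) '' Ioc 0 1)
  set S := sSup ((fun u : ℝ => f u / u) '' Ioc 0 1)
  have hle : ∀ u ∈ Ioo (0 : ℝ) 1, q u / u ≤ M := fun u hu =>
    le_csSup hq (mem_image_of_mem _ ⟨hu.1, hu.2.le⟩)
  have hhalf : (1 / 2 : ℝ) ∈ Ioo (0 : ℝ) 1 := by norm_num
  have hM : 0 < M := (div_pos (hd.q_pos _ hhalf) hhalf.1).trans_le (hle _ hhalf)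
  have hsub : IsSingularSubsolution f q (2 * √M + S) (fun u => √M * u) := by
    refine IsSingularSubsolution.linear hd (S := S) (M := M) (Real.sqrt_pos.2 hM) (fun u hu => ?_)
      (fun u hu => (div_le_iff₀ hu.1).1 (hle u hu)) ?_
    · exact (div_le_iff₀ hu.1).1
        (le_csSup hd.bddAbove_f_div (mem_image_of_mem (fun u => f u / u) ⟨hu.1, hu.2.le⟩))
    · rw [Real.div_sqrt]
      linarith
  obtain ⟨w, hw, -⟩ := hsub.exists_maximal_solution hd
  exact ⟨w, hw⟩

lemma IsSingularSolution.deriv_zero_le_speed {f h q w : ℝ → ℝ} {c : ℝ}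
    (hw : IsSingularSolution h q c w) (hd : IsSingularData f h q)
    (hf : HasDerivWithinAt f (h 0) (Icc 0 1) 0) : h 0 ≤ c := by
  have h1 : Tendsto (slope f 0) (𝓝[>] 0) (𝓝 (h 0)) :=
    (hasDerivWithinAt_iff_tendsto_slope' self_notMem_Ioi).1
      (hf.mono_of_mem_nhdsWithin (Icc_mem_nhdsGT (zero_lt_one (α := ℝ))))
  refine le_of_tendsto h1 ?_
  filter_upwards [Ioc_mem_nhdsGT (zero_lt_one (α := ℝ))] with u hu
  rw [slope_def_field, hd.f_zero, sub_zero, sub_zero]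
  exact hw.div_le_speed hd hu

/-- The linear speed `h 0 + 2 √(liminf q / u)` is a lower bound for the admissible speeds. -/
lemma IsSingularSolution.linear_speed_le {f h q w : ℝ → ℝ} {c : ℝ}
    (hw : IsSingularSolution h q c w) (hd : IsSingularData f h q)
    (hf : HasDerivWithinAt f (h 0) (Icc 0 1) 0) :
    h 0 + 2 * √(liminf (fun u : ℝ => q u / u) (𝓝[>] 0)) ≤ c := by
  set L := liminf (fun u : ℝ => q u / u) (𝓝[>] 0)
  rcases le_or_gt L 0 with hL | hL
  · rw [Real.sqrt_eq_zero_of_nonpos hL, mul_zero, add_zero]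
    exact hw.deriv_zero_le_speed hd hf
  · have h1 : Tendsto (fun l => h 0 + 2 * √l) (𝓝[<] L) (𝓝 (h 0 + 2 * √L)) :=
      (Continuous.tendsto (by fun_prop) L).mono_left nhdsWithin_le_nhds
    refine le_of_tendsto h1 ?_
    filter_upwards [Ioo_mem_nhdsLT hL] with l hl
    refine hw.add_two_mul_sqrt_le_speed hd hl.1 ?_
    have hbdd : IsBoundedUnder (· ≥ ·) (𝓝[>] (0 : ℝ)) fun u => q u / u := by
      refine ⟨0, ?_⟩
      rw [eventually_map]
      filter_upwards [Ioo_mem_nhdsGT (zero_lt_one (α := ℝ))] with u hu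
      exact (div_pos (hd.q_pos u hu) hu.1).le
    filter_upwards [eventually_lt_of_lt_liminf hl.2 hbdd, self_mem_nhdsWithin] with u hu hu0
    exact ((lt_div_iff₀ hu0).1 hu).le

theorem mainTheorem1 (f D g : ℝ → ℝ)
    (hf : ContDiffOn ℝ 1 f (Icc 0 1)) (hf0 : f 0 = 0)
    (hD : ContDiffOn ℝ 1 D (Icc 0 1)) (hDpos : ∀ u ∈ Ioo (0 : ℝ) 1, 0 < D u) (hD1 : D 1 = 0)
    (hg : ContinuousOn g (Icc 0 1)) (hgpos : ∀ u ∈ Ioc (0 : ℝ) 1, 0 < g u) (hg0 : g 0 = 0)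
    (hDg : limsup (fun u : ℝ => ((D u * g u / u : ℝ) : EReal)) (𝓝[>] 0) < ⊤) :
    ∃ cstar : ℝ,
      max (sSup ((fun u : ℝ => f u / u) '' Ioc 0 1))
          (derivWithin f (Icc 0 1) 0 +
            2 * Real.sqrt (liminf (fun u : ℝ => D u * g u / u) (𝓝[>] 0))) ≤ cstar ∧
      cstar ≤ 2 * Real.sqrt (sSup ((fun u : ℝ => D u * g u / u) '' Ioc 0 1)) +
          sSup ((fun u : ℝ => f u / u) '' Ioc 0 1) ∧
      (∀ c : ℝ, (∃ (a : ℝ) (φ : ℝ → ℝ), IsStrictSemiWavefrontOneZero f D g a c φ) ↔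
        cstar ≤ c) ∧
      ∀ (c a : ℝ) (φ : ℝ → ℝ), IsStrictSemiWavefrontOneZero f D g a c φ →
        ∀ ξ ∈ Ioi a, 0 < φ ξ → φ ξ < 1 → deriv φ ξ < 0 := by
  have hfd : ∀ u ∈ Icc (0 : ℝ) 1, HasDerivWithinAt f (derivWithin f (Icc 0 1) u) (Icc 0 1) u :=
    fun u hu => (hf.differentiableOn (by simp) u hu).hasDerivWithinAt
  have hd : IsWaveData f (derivWithin f (Icc 0 1)) D g :=
    { continuousOn_f := hf.continuousOn
      f_zero := hf0
      continuousOn_h := hf.continuousOn_derivWithin (uniqueDiffOn_Icc zero_lt_one) le_rfl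
      hasDerivAt_f := fun u hu =>
        (hfd u (Ioo_subset_Icc_self hu)).hasDerivAt (Icc_mem_nhds hu.1 hu.2)
      continuousOn_q := hD.continuousOn.mul hg
      q_pos := fun u hu => mul_pos (hDpos u hu) (hgpos u ⟨hu.1, hu.2.le⟩)
      continuousOn_D := hD.continuousOn
      D_pos := hDpos
      continuousOn_g := hg
      g_pos := hgpos
      g_zero := hg0 }
  have hs := hd.toIsSingularData
  obtain ⟨cstar, hle, hiff⟩ :=
    hs.exists_threshold (hs.exists_isSingularSolution (hs.bddAbove_q_div hDg))
  obtain ⟨w, hw⟩ := (hiff cstar).2 le_rfl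
  refine ⟨cstar, max_le ?_ ?_, hle, fun c => ?_, ?_⟩
  · refine csSup_le ⟨_, mem_image_of_mem _ ⟨one_pos, le_rfl⟩⟩ ?_
    rintro _ ⟨u, hu, rfl⟩
    exact hw.div_le_speed hs hu
  · exact hw.linear_speed_le hs (hfd 0 ⟨le_rfl, zero_le_one⟩)
  · rw [hd.exists_isStrictSemiWavefrontOneZero_iff c, hiff c]
  · rintro c a φ ⟨hφ, -, hlim1⟩ ξ hξ h0 h1
    obtain ⟨z, hz⟩ := hφ.isTravelingWaveProfile.exists_isFlux hd
    have hanti := antitoneOn_of_tendsto_one_zero hφ.monotonic hφ.tendsto_atTop hlim1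
    rw [(hz.hasDerivAt_profile hd hξ ⟨h0, h1⟩).deriv]
    exact div_neg_of_neg_of_pos (hz.flux_neg hd hanti hξ ⟨h0, h1⟩) (hd.D_pos _ ⟨h0, h1⟩)
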